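/- Let $\Bbbk$ be a field of characteristic zero, let $\mathbf n=(n_1,\dots,n_d)$ be a tuple of natural numbers, let $\mathbf r=(r_1,\dots,r_m)$ be a tuple of integers with all $r_k\ge 2$, and put $R=r_1\cdots r_m$. Let $\mathcal S\subset \Bbbk^{n_1\times\cdots\times n_d}$ be the set of rank-$1$ tensors, $\mathcal S^*\subset\mathcal S$ the subset of those with all entries nonzero, and let $\circledast$ denote the Hadamard (entrywise) product. An $\mathbf r$-Hadamard--Hitchcock decomposition ($\mathbf r$-HHD) of a tensor $\mathcal T$ is a family $(\mathcal A_{k,i})_{1\le k\le m,\,1\le i\le r_k}$ of elements of $\mathcal S$ with $$\mathcal T=\Big(\sum_{i=1}^{r_1}\mathcal A_{1,i}\Big)\circledast\cdots\circledast\Big(\sum_{i=1}^{r_m}\mathcal A_{m,i}\Big),$$ considered up to permuting the summands inside each factor and permuting factors of equal length $r_k$. An essential $\mathbf r$-HHD of $\mathcal T$ is a class of $\mathbf r$-HHDs of $\mathcal T$ modulo the operations $\mathcal A_{k,i}\mapsto \mathcal D_k\circledast\mathcal A_{k,i}$ with $\mathcal D_1,\dots,\mathcal D_m\in\mathcal S^*$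 and $\mathcal D_1\circledast\cdots\circledast\mathcal D_m=\mathbf 1\otimes\cdots\otimes\mathbf 1$, the tensor filled with ones. The tensor $\mathcal T$ is $\mathbf r$-identifiable if it has exactly one essential $\mathbf r$-HHD. Let $\sigma^\circ_{\mathbf r}$ be the set of tensors admitting an $\mathbf r$-HHD and $\sigma_{\mathbf r}$ its Zariski closure in $\Bbbk^{n_1\times\cdots\times n_d}$. Suppose that there is a partition $\{1,\dots,d\}=I\sqcup J\sqcup K$ such that, with $\Pi_X:=\prod_{x\in X}n_x$ and $\delta:=\Pi_J+\Pi_K-\Pi_I-2$, $$\Pi_I\ge\Pi_J\ge\Pi_K\ge 2\qquad\text{and}\qquad R\le \Pi_I+\min\{\tfrac12\delta,\ \delta\}$$ (that is, $R$ lies in the range of applicability of the reshaped Kruskal criterion). Then a generic tensor admitting an $\mathbf r$-HHD has a unique essential $\mathbf r$-HHD: there is a Zariski closed set $\mathcal Z\subsetneq\sigma_{\mathbf r}$ such that every $\mathcal T\in\sigma^\circ_{\mathbf r}\setminus\mathcal Z$ is $\mathbf r$-identifiable. If moreover $\Bbbk$ is algebraically closed, then, for the same $\mathcal Z$, every $\mathcal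 T\in\sigma_{\mathbf r}\setminus\mathcal Z$ is $\mathbf r$-identifiable (in particular, it admits an $\mathbf r$-HHD). -/

import Mathlib

namespace HHD

/-- Tensors of shape `n 0 × ⋯ × n (d-1)`, as arrays of coordinates. The pointwise multiplication of
functions is the Hadamard product, and `1` is the tensor filled with ones. -/
abbrev Tensor (K : Type*) {d : ℕ} (n : Fin d → ℕ) : Type _ :=
  (∀ i : Fin d, Fin (n i)) → K

/-- The decomposable tensor `a 0 ⊗ ⋯ ⊗ a (d-1)`. -/
def outer {K : Type*} [Field K] {d : ℕ} {n : Fin d → ℕ} (a : ∀ i : Fin d, Fin (n i) → K) :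
    Tensor K n :=
  fun j => ∏ i, a i (j i)

/-- The set `S` of tensors of rank (exactly) one. -/
def segre (K : Type*) [Field K] {d : ℕ} (n : Fin d → ℕ) : Set (Tensor K n) :=
  {A | A ≠ 0 ∧ ∃ a : ∀ i : Fin d, Fin (n i) → K, A = outer a}

/-- The set `S*` of rank-one tensors all of whose entries are nonzero. -/
def segreStar (K : Type*) [Field K] {d : ℕ} (n : Fin d → ℕ) : Set (Tensor K n) :=
  {A | A ∈ segre K n ∧ ∀ j, A j ≠ 0}

/-- Ordered families `A k i` of tensors, with `r k` tensors in the `k`-th Hadamard factor. -/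
abbrev Family (K : Type*) {d m : ℕ} (n : Fin d → ℕ) (r : Fin m → ℕ) : Type _ :=
  ∀ k : Fin m, Fin (r k) → Tensor K n

/-- The ordered family `A` is an `r`-Hadamard–Hitchcock decomposition of `T`: all its members have
rank one, and `T` is the Hadamard product over `k` of the sums `∑ i, A k i`. -/
def IsHHD {K : Type*} [Field K] {d m : ℕ} {n : Fin d → ℕ} {r : Fin m → ℕ}
    (A : Family K n r) (T : Tensor K n) : Prop :=
  (∀ k i, A k i ∈ segre K n) ∧ T = ∏ k, ∑ i, A k i

/-- The tensors admitting an `r`-Hadamard–Hitchcock decomposition. -/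
def hhdTensors (K : Type*) [Field K] {d m : ℕ} (n : Fin d → ℕ) (r : Fin m → ℕ) :
    Set (Tensor K n) :=
  {T | ∃ A : Family K n r, IsHHD A T}

/-- Zariski closed subsets of an affine space. -/
def IsZariskiClosed {K ι : Type*} [Field K] (Z : Set (ι → K)) : Prop :=
  ∃ I : Ideal (MvPolynomial ι K), Z = MvPolynomial.zeroLocus K I

/-- The Zariski closure of a subset of an affine space. -/
def zariskiClosure {K ι : Type*} [Field K] (V : Set (ι → K)) : Set (ι → K) :=
  MvPolynomial.zeroLocus K (MvPolynomial.vanishingIdeal K V)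

/-- The variety of tensors admitting an `r`-Hadamard–Hitchcock decomposition. -/
def hhdVariety (K : Type*) [Field K] {d m : ℕ} (n : Fin d → ℕ) (r : Fin m → ℕ) :
    Set (Tensor K n) :=
  zariskiClosure (hhdTensors K n r)

/-- Two ordered families are identified if they differ by a permutation `ψ` of the Hadamard factors
that preserves `r` (this is what the existence of the bijections `π k` expresses) and by
permutations of the members of each factor. -/
def permSetoid (K : Type*) {d m : ℕ} (n : Fin d → ℕ) (r : Fin m → ℕ) :
    Setoid (Family K n r) where
  r A B := ∃ (ψ : Equiv.Perm (Fin m)) (π : ∀ k, Fin (r k) ≃ Fin (r (ψ k))),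
    ∀ k i, B k i = A (ψ k) (π k i)
  iseqv := by
    refine ⟨fun A => ⟨Equiv.refl _, fun k => Equiv.refl _, fun k i => rfl⟩, ?_, ?_⟩
    · rintro A B ⟨ψ, π, h⟩
      have aux : ∀ (k l : Fin m) (e : k = l) (i : Fin (r k)),
          A l (finCongr (congrArg r e) i) = A k i := by
        intro k l e i
        subst e
        rfl
      refine ⟨ψ.symm, fun k => (finCongr (congrArg r (ψ.apply_symm_apply k).symm)).trans
        (π (ψ.symm k)).symm, fun k i => ?_⟩
      rw [h, Equiv.trans_apply]
      exact ((congrArg (A (ψ (ψ.symm k))) (Equiv.apply_symm_apply _ _)).trans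
        (aux k _ (ψ.apply_symm_apply k).symm i)).symm
    · rintro A B C ⟨ψ, π, h⟩ ⟨ψ', π', h'⟩
      exact ⟨ψ'.trans ψ, fun k => (π' k).trans (π (ψ' k)), fun k i => by
        rw [h', h]; rfl⟩

/-- Families of tensors up to reordering inside the factors and reordering of factors of equal
length. -/
def UnorderedFamily (K : Type*) {d m : ℕ} (n : Fin d → ℕ) (r : Fin m → ℕ) : Type _ :=
  Quotient (permSetoid K n r)

/-- The class of an ordered family. -/
def Family.toUnordered {K : Type*} {d m : ℕ} {n : Fin d → ℕ} {r : Fin m → ℕ}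
    (A : Family K n r) : UnorderedFamily K n r :=
  Quotient.mk (permSetoid K n r) A

/-- The set of `r`-Hadamard–Hitchcock decompositions of `T`. -/
def hhds {K : Type*} [Field K] {d m : ℕ} {n : Fin d → ℕ} (r : Fin m → ℕ) (T : Tensor K n) :
    Set (UnorderedFamily K n r) :=
  {H | ∃ A : Family K n r, IsHHD A T ∧ Family.toUnordered A = H}

/-- The orbit of `H` under Hadamard multiplication of the factors by tensors
`D 0, …, D (m-1) ∈ S*` whose Hadamard product is the tensor of ones. -/
def starOrbit {K : Type*} [Field K] {d m : ℕ} {n : Fin d → ℕ} {r : Fin m → ℕ}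
    (H : UnorderedFamily K n r) : Set (UnorderedFamily K n r) :=
  {H' | ∃ (A : Family K n r) (D : Fin m → Tensor K n), Family.toUnordered A = H ∧
    (∀ k, D k ∈ segreStar K n) ∧ ∏ k, D k = 1 ∧
    H' = Family.toUnordered (fun k i => D k * A k i)}

/-- The set of essential `r`-Hadamard–Hitchcock decompositions of `T`. -/
def essentialHHDs {K : Type*} [Field K] {d m : ℕ} {n : Fin d → ℕ} (r : Fin m → ℕ)
    (T : Tensor K n) : Set (Set (UnorderedFamily K n r)) :=
  starOrbit '' hhds r T

/-- `T` is `r`-identifiable: it has exactly one essential `r`-Hadamard–Hitchcock decomposition. -/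
def Identifiable {K : Type*} [Field K] {d m : ℕ} {n : Fin d → ℕ} (r : Fin m → ℕ)
    (T : Tensor K n) : Prop :=
  ∃ E, essentialHHDs r T = {E}

/-- The product of the dimensions `n x`, for `x ∈ X`. -/
def dimProd {d : ℕ} (n : Fin d → ℕ) (X : Finset (Fin d)) : ℕ :=
  ∏ x ∈ X, n x

/-- The quantity `δ = Π_J + Π_K - Π_I - 2`. -/
def kruskalDelta {d : ℕ} (n : Fin d → ℕ) (I J K : Finset (Fin d)) : ℚ :=
  (dimProd n J : ℚ) + dimProd n K - dimProd n I - 2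

/-- `R` lies in the range of applicability of the reshaped Kruskal criterion for the shape `n`:
for some partition `I ⊔ J ⊔ K` of the modes with `Π_I ≥ Π_J ≥ Π_K ≥ 2`, one has
`R ≤ Π_I + min (δ / 2) δ`. -/
def InKruskalRange {d : ℕ} (n : Fin d → ℕ) (R : ℕ) : Prop :=
  ∃ I J K : Finset (Fin d),
    Disjoint I J ∧ Disjoint I K ∧ Disjoint J K ∧ I ∪ J ∪ K = Finset.univ ∧
    dimProd n J ≤ dimProd n I ∧ dimProd n K ≤ dimProd n J ∧ 2 ≤ dimProd n K ∧
    (R : ℚ) ≤ (dimProd n I : ℚ) + min (kruskalDelta n I J K / 2) (kruskalDelta n I J K)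

end HHD

/-! Expanding the Hadamard product of sums turns an HHD into a sum of `R` decomposable tensors, one
for each multi-index `i`, namely the product of the `A k (i k)`. Grouping the modes into three
blocks makes this a three-way decomposition. For a generic family the Kruskal rank in each block is
`min R Π`, so Kruskal's theorem (`exists_perm_of_sum_eq`) shows that any other HHD of the same
tensor has the same expansion up to a permutation `τ` of the multi-indices.

It remains to see that `τ` respects the grid. If the unordered pairs `{i k, j k}` and `{i' k, j' k}`
agree for every `k`, then the terms at `i`, `j` have the same product as those at `i'`, `j'`. In a
generic family these are the only such coincidences, so `τ` preserves the relation, and a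
combinatorial argument (`exists_perm_of_preserves_pairs`) makes it a permutation of directions and
of coordinates in each direction. The factors are then equal up to reordering and scaling, the
scalings being quotients of summands (`starEquiv_of_prod_eq`).

Kruskal's theorem rests on a splitting inequality: product vectors that do not split span at least
the sum of the ranks of their factors, minus the number of factors, plus one. It is applied to
minimal zero-sum subfamilies of the two decompositions taken together.

Genericity is the nonvanishing of a polynomial `g` on parameters. By Chevalley's theorem there is
`f`, nonzero on the image, such that every point of the closure with `f ≠ 0` lifts to a parameter
with `g ≠ 0` over any algebraically closed extension. Decompositions over `K` are compared through
this lift; if `K` is algebraically closed, the lift itself is a decomposition. -/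

/-! ### Ranks of subfamilies and of product vectors -/

section
open Module Submodule

/-- Rank–nullity for the quotient map by a submodule, restricted to a larger submodule. -/
theorem finrank_map_mkQ_add_finrank {K V : Type*} [Field K] [AddCommGroup V] [Module K V]
    [FiniteDimensional K V] {W P : Submodule K V} (h : W ≤ P) :
    finrank K (P.map W.mkQ) + finrank K W = finrank K P := by
  have h1 := (W.mkQ.domRestrict P).finrank_range_add_finrank_ker
  rw [LinearMap.range_domRestrict, LinearMap.ker_domRestrict, ker_mkQ] at h1
  rw [← h1, ← (Submodule.comapSubtypeEquivOfLe h).finrank_eq]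

/-- The rank of the subfamily of `x` indexed by `S`. -/
noncomputable def familyRank (K : Type*) {ι V : Type*} [Field K] [AddCommGroup V] [Module K V]
    (x : ι → V) (S : Finset ι) : ℕ :=
  finrank K (span K (x '' S))

section Family
variable {K ι V : Type*} [Field K] [AddCommGroup V] [Module K V]

theorem familyRank_le_card (x : ι → V) (S : Finset ι) : familyRank K x S ≤ S.card := by
  classical
  have := finrank_span_finset_le_card (R := K) (S.image x)
  rw [Finset.coe_image] at this
  exact this.trans Finset.card_image_le

theorem familyRank_mono [FiniteDimensional K V] (x : ι → V) {S T : Finset ι} (h : S ⊆ T) :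
    familyRank K x S ≤ familyRank K x T :=
  Submodule.finrank_mono (span_mono (Set.image_mono (by exact_mod_cast h)))

theorem familyRank_eq_card {x : ι → V} {S : Finset ι}
    (h : LinearIndependent K (fun a : S => x a)) : familyRank K x S = S.card := by
  have := finrank_span_eq_card h
  rw [Fintype.card_coe] at this
  rw [← this, familyRank, Set.image_eq_range]
  rfl

theorem familyRank_singleton_le (x : ι → V) (a : ι) : familyRank K x {a} ≤ 1 := by
  simpa using familyRank_le_card (K := K) x {a}

theorem mem_span_image_finset {x : ι → V} {S : Finset ι} {s : V} (h : s ∈ span K (x '' S)) :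
    ∃ c : ι → K, ∑ a ∈ S, c a • x a = s :=
  (mem_span_image_finset_iff_exists_fun' K).1 h

theorem sum_smul_mem_span_image (x : ι → V) (S : Finset ι) (c : ι → K) :
    ∑ a ∈ S, c a • x a ∈ span K (x '' S) :=
  sum_mem fun a ha => smul_mem _ _ (subset_span ⟨a, ha, rfl⟩)

variable [DecidableEq ι]

/-- If the spans of two subfamilies meet, some subfamily `T` of the second one adds only
`#T - 1` to the rank of the first one, and this is witnessed by a relation with nonzero
coefficients on `T`. -/
theorem exists_circuit_of_not_disjoint [FiniteDimensional K V] (x : ι → V) (S F : Finset ι)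
    (h : ¬ Disjoint (span K (x '' S)) (span K (x '' F))) :
    ∃ T ⊆ F, T.Nonempty ∧ ∃ c : ι → K, (∀ a ∈ T, c a ≠ 0) ∧
      ∑ a ∈ T, c a • x a ∈ span K (x '' S) ∧ ∑ a ∈ T, c a • x a ≠ 0 ∧
      familyRank K x S + T.card ≤ familyRank K x (S ∪ T) + 1 := by
  let P : Finset ι → Prop := fun T => T ⊆ F ∧ ∃ c : ι → K,
    ∑ a ∈ T, c a • x a ∈ span K (x '' S) ∧ ∑ a ∈ T, c a • x a ≠ 0
  have hP : ∃ T, P T := by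
    rw [Submodule.disjoint_def] at h
    push Not at h
    obtain ⟨s, h1, h2, h3⟩ := h
    obtain ⟨c, rfl⟩ := mem_span_image_finset h2
    exact ⟨F, subset_rfl, c, h1, h3⟩
  obtain ⟨T, hT, hmin⟩ : ∃ T, P T ∧ ∀ T', T' ⊂ T → ¬ P T' := by
    obtain ⟨T, hT⟩ := exists_minimal_of_wellFoundedLT P hP
    exact ⟨T, hT.1, fun T' h' hP' => h'.2 (hT.2 hP' h'.1)⟩
  obtain ⟨hTF, c, hc, hc0⟩ := hT
  have hne : T.Nonempty := by
    rw [Finset.nonempty_iff_ne_empty]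
    rintro rfl
    simp at hc0
  -- Minimality of `T`: a combination in the span of `S` that omits some member of `T` must vanish.
  have hcT : ∀ (t : ι) (d : ι → K), t ∈ T → d t = 0 →
      ∑ a ∈ T, d a • x a ∈ span K (x '' S) → ∑ a ∈ T, d a • x a = 0 := by
    intro t d ht hd hm
    by_contra h0
    refine hmin (T.erase t) (Finset.erase_ssubset ht)
      ⟨(Finset.erase_subset _ _).trans hTF, d, ?_⟩
    have : ∑ a ∈ T.erase t, d a • x a = ∑ a ∈ T, d a • x a := by
      rw [← Finset.add_sum_erase _ _ ht, hd, zero_smul, zero_add]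
    rw [this]
    exact ⟨hm, h0⟩
  refine ⟨T, hTF, hne, c, fun a ha h0 => hc0 (hcT a c ha h0 hc), hc, hc0, ?_⟩
  obtain ⟨t, ht⟩ := hne
  -- A dependence modulo the span of `S` extends by zero to `d` with `d t = 0`, so its sum is zero;
  -- subtracting a multiple of `d` from `c` kills a coefficient without changing the nonzero sum,
  -- against minimality.
  have key : LinearIndependent K (fun a : (T.erase t : Finset ι) =>
      (span K (x '' S)).mkQ (x a)) := by
    rw [linearIndependent_iff']
    by_contra hdep
    push Not at hdep
    obtain ⟨s, g, hg, b, hb, hgb⟩ := hdep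
    let d : ι → K := fun a => if h : ∃ h : a ∈ T.erase t, (⟨a, h⟩ : (T.erase t : Finset ι)) ∈ s
      then g ⟨a, h.1⟩ else 0
    have hdt : d t = 0 := by simp [d]
    have hdb : d b = g b := by
      have : ∃ h : (b : ι) ∈ T.erase t, (⟨b, h⟩ : (T.erase t : Finset ι)) ∈ s := ⟨b.2, hb⟩
      simp only [d, dif_pos this]
    have hbT : (b : ι) ∈ T := Finset.mem_of_mem_erase b.2
    have hsum : ∑ a ∈ T, d a • x a = ∑ a ∈ s, g a • x a := by
      rw [← Finset.add_sum_erase _ _ ht, hdt, zero_smul, zero_add, ← Finset.sum_coe_sort]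
      rw [← Finset.sum_subset (Finset.subset_univ s)]
      · refine Finset.sum_congr rfl fun a ha => ?_
        have : ∃ h : (a : ι) ∈ T.erase t, (⟨a, h⟩ : (T.erase t : Finset ι)) ∈ s := ⟨a.2, ha⟩
        simp only [d, dif_pos this]
      · intro a _ ha
        have : ¬ ∃ h : (a : ι) ∈ T.erase t, (⟨a, h⟩ : (T.erase t : Finset ι)) ∈ s :=
          fun h => ha h.2
        simp only [d, dif_neg this, zero_smul]
    have hmem : ∑ a ∈ T, d a • x a ∈ span K (x '' S) := by
      rw [hsum, ← (span K (x '' S)).ker_mkQ, LinearMap.mem_ker, map_sum, ← hg]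
      simp only [map_smul]
    have hz := hcT t d ht hdt hmem
    have hz2 : ∑ a ∈ T, (c a - c b / d b * d a) • x a = ∑ a ∈ T, c a • x a := by
      simp only [sub_smul, Finset.sum_sub_distrib, mul_smul, ← Finset.smul_sum]
      rw [hz, smul_zero, sub_zero]
    have hdb0 : d b ≠ 0 := by rw [hdb]; exact hgb
    have := hcT b (fun a => c a - c b / d b * d a) hbT (by field_simp; ring)
      (by rw [hz2]; exact hc)
    rw [hz2] at this
    exact hc0 this
  have h1 : span K (x '' S) ≤ span K (x '' ((S ∪ T : Finset ι) : Set ι)) :=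
    span_mono (Set.image_mono (by simp))
  have h2 := finrank_map_mkQ_add_finrank h1
  have h3 : T.card - 1 ≤ finrank K ((span K (x '' ((S ∪ T : Finset ι) : Set ι))).map
      (span K (x '' S)).mkQ) := by
    have h4 := finrank_span_eq_card key
    rw [Fintype.card_coe, Finset.card_erase_of_mem ht] at h4
    rw [← h4]
    refine Submodule.finrank_mono (span_le.2 ?_)
    rintro _ ⟨a, rfl⟩
    exact mem_map_of_mem (subset_span ⟨a, by
      simp [Finset.mem_of_mem_erase a.2], rfl⟩)
  have h5 : 0 < T.card := Finset.card_pos.2 ⟨t, ht⟩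
  simp only [familyRank]
  omega

/-- The rank bound on the left factors coming from a relation between product vectors. -/
theorem familyRank_union_add_le [FiniteDimensional K V] {α : Type*} [Finite α]
    (u : ι → α → K) (v : ι → V) (S T : Finset ι) (c : ι → K) (hc : ∀ a ∈ T, c a ≠ 0)
    (hm : ∑ a ∈ T, c a • (fun i => u a i • v a) ∈
      span K ((fun a i => u a i • v a : ι → α → V) '' S)) :
    familyRank K u (S ∪ T) + familyRank K v T ≤ familyRank K u S + T.card := by
  set W := span K (u '' S) with hW
  let L := Fintype.linearCombination K (fun a : T => W.mkQ (u a))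
  let G := Fintype.linearCombination K (fun a : T => c a • v a)
  let e : Dual K (T → K) →ₗ[K] (T → K) := LinearMap.pi fun a => Dual.eval K _ (Pi.single a 1)
  have he : Function.Injective e := by
    intro f g hfg
    refine LinearMap.pi_ext' fun a => LinearMap.ext_ring ?_
    exact congrFun hfg a
  have hG : finrank K (LinearMap.range G) = familyRank K v T := by
    suffices h : LinearMap.range G = span K (v '' T) by rw [h, familyRank]
    rw [Fintype.range_linearCombination]
    refine le_antisymm (span_le.2 ?_) (span_le.2 ?_)
    · rintro _ ⟨a, rfl⟩
      exact smul_mem _ _ (subset_span ⟨a, a.2, rfl⟩)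
    · rintro _ ⟨a, ha, rfl⟩
      have : c a • v a ∈ span K (Set.range fun a : T => c a • v a) :=
        subset_span ⟨⟨a, ha⟩, rfl⟩
      exact (smul_mem_iff _ (hc a ha)).1 this
  have hL : finrank K (LinearMap.range L) + familyRank K u S = familyRank K u (S ∪ T) := by
    have h1 : W ≤ span K (u '' ((S ∪ T : Finset ι) : Set ι)) :=
      span_mono (Set.image_mono (by simp))
    have h2 := finrank_map_mkQ_add_finrank h1
    suffices h : LinearMap.range L =
        (span K (u '' ((S ∪ T : Finset ι) : Set ι))).map W.mkQ by
      rw [familyRank, familyRank, ← h2, h]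
    rw [Fintype.range_linearCombination, map_span]
    refine le_antisymm (span_le.2 ?_) (span_le.2 ?_)
    · rintro _ ⟨a, rfl⟩
      exact subset_span ⟨_, ⟨a, by simp, rfl⟩, rfl⟩
    · rintro _ ⟨_, ⟨a, ha, rfl⟩, rfl⟩
      by_cases haT : a ∈ T
      · exact subset_span ⟨⟨a, haT⟩, rfl⟩
      · have haS : a ∈ S := by
          have : a ∈ S ∪ T := ha
          simpa [haT] using this
        have : W.mkQ (u a) = 0 := by
          rw [← LinearMap.mem_ker, ker_mkQ]
          exact subset_span ⟨a, haS, rfl⟩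
        rw [SetLike.mem_coe, this]
        exact zero_mem _
  -- Contracting the relation with a functional `ψ` on the second factor gives a relation among the
  -- `u a` modulo `W`, with coefficients `c a * ψ (v a)`. These vectors form a space of dimension
  -- `familyRank K v T` inside `ker L`.
  have hker : (LinearMap.range G.dualMap).map e ≤ LinearMap.ker L := by
    rintro _ ⟨_, ⟨ψ, rfl⟩, rfl⟩
    have h1 : L (e (G.dualMap ψ)) = W.mkQ (∑ a ∈ T, c a • ψ (v a) • u a) := by
      have h0 : ∀ a : T, e (G.dualMap ψ) a = c a * ψ (v a) := fun a => by
        simp [e, G, Dual.eval]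
      rw [← Finset.sum_coe_sort, map_sum]
      simp only [L, Fintype.linearCombination_apply, h0, mul_smul, map_smul]
    rw [LinearMap.mem_ker, h1, ← LinearMap.mem_ker, ker_mkQ]
    have h2 := mem_map_of_mem (f := ψ.compLeft α) hm
    rw [map_span, map_sum] at h2
    have h3 : ∀ a, (ψ.compLeft α) (fun i => u a i • v a) = ψ (v a) • u a := by
      intro a
      ext i
      simp [mul_comm]
    simp only [map_smul, h3] at h2
    refine (span_le.2 ?_) h2
    rintro _ ⟨_, ⟨a, ha, rfl⟩, rfl⟩
    rw [h3]
    exact smul_mem _ _ (subset_span ⟨a, ha, rfl⟩)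
  have h6 := L.finrank_range_add_finrank_ker
  have h7 := Submodule.finrank_mono hker
  rw [← (Submodule.equivMapOfInjective e he _).finrank_eq,
    LinearMap.finrank_range_dualMap_eq_finrank_range, hG] at h7
  simp at h6
  omega

end Family

end

/-! ### The splitting inequality and Kruskal's theorem -/

section
open Module Submodule

section Split
variable {K ι V : Type*} [Field K] [AddCommGroup V] [Module K V] [DecidableEq ι]

/-- The family `x` on `F` splits if its span is the direct sum of the spans of two complementary
nonempty subfamilies. -/
def Splits (K : Type*) {ι V : Type*} [Field K] [AddCommGroup V] [Module K V] [DecidableEq ι]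
    (x : ι → V) (F : Finset ι) : Prop :=
  ∃ S ⊆ F, S.Nonempty ∧ S ≠ F ∧ Disjoint (span K (x '' S)) (span K (x '' (F \ S : Finset ι)))

omit [DecidableEq ι] in
theorem apply_mem_span_of_mem_span_smul {α : Type*} (u : ι → α → K) (v : ι → V) (S : Set ι)
    {s : α → V} (hs : s ∈ span K ((fun a i => u a i • v a : ι → α → V) '' S)) (i : α) :
    s i ∈ span K (v '' S) := by
  have h2 := mem_map_of_mem (f := (LinearMap.proj i : (α → V) →ₗ[K] V)) hs
  rw [map_span] at h2
  refine (span_le.2 ?_) h2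
  rintro _ ⟨_, ⟨a, ha, rfl⟩, rfl⟩
  exact smul_mem _ _ (subset_span ⟨a, ha, rfl⟩)

-- Each slice of a combination of product vectors is a combination of the `v a`, so a common element
-- has all its slices zero.
omit [DecidableEq ι] in
theorem disjoint_span_smul {α : Type*} (u : ι → α → K) (v : ι → V) {S T : Set ι}
    (h : Disjoint (span K (v '' S)) (span K (v '' T))) :
    Disjoint (span K ((fun a i => u a i • v a : ι → α → V) '' S))
      (span K ((fun a i => u a i • v a : ι → α → V) '' T)) := by
  rw [Submodule.disjoint_def] at h ⊢
  intro s h1 h2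
  funext i
  exact h _ (apply_mem_span_of_mem_span_smul u v S h1 i)
    (apply_mem_span_of_mem_span_smul u v T h2 i)

theorem Splits.smul {α : Type*} (u : ι → α → K) {v : ι → V} {F : Finset ι}
    (h : Splits K v F) : Splits K (fun a i => u a i • v a : ι → α → V) F := by
  obtain ⟨S, h1, h2, h3, h4⟩ := h
  exact ⟨S, h1, h2, h3, disjoint_span_smul u v h4⟩

/-- A non-splitting family of product vectors spans a space of dimension at least the sum of the
dimensions spanned by the factors, minus one. -/
theorem add_familyRank_le_of_not_splits [FiniteDimensional K V] {α : Type*} [Finite α]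
    (u : ι → α → K) (v : ι → V) {F : Finset ι} (hF : F.Nonempty)
    (h : ¬ Splits K (fun a i => u a i • v a : ι → α → V) F) :
    familyRank K u F + familyRank K v F ≤
      familyRank K (fun a i => u a i • v a : ι → α → V) F + 1 := by
  set x : ι → α → V := fun a i => u a i • v a with hx
  let P : Finset ι → Prop := fun S => S ⊆ F ∧ S.Nonempty ∧
    familyRank K u S + familyRank K v S ≤ familyRank K x S + 1
  have hP : ∃ S, P S := by
    obtain ⟨a, ha⟩ := hF
    refine ⟨{a}, by simpa using ha, by simp, ?_⟩
    have h1 := familyRank_singleton_le (K := K) u a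
    have h2 := familyRank_singleton_le (K := K) v a
    by_cases hu : u a = 0
    · have : familyRank K u {a} = 0 := by simp [familyRank, hu]
      omega
    by_cases hv : v a = 0
    · have : familyRank K v {a} = 0 := by simp [familyRank, hv]
      omega
    have hxa : x a ≠ 0 := by
      obtain ⟨i, hi⟩ := Function.ne_iff.1 hu
      intro h0
      exact smul_ne_zero hi hv (congrFun h0 i)
    have : familyRank K x {a} = 1 := by
      rw [familyRank, Finset.coe_singleton, Set.image_singleton, finrank_span_singleton hxa]
    omega
  -- A maximal good `S` must be `F`: otherwise a circuit `T` raises the rank of `u` by at most `#T -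
  -- rank v T`, that of `v` by at most `rank v T - 1`, and that of `x` by at least `#T - 1`, so `S ∪
  -- T` is good.
  obtain ⟨S, ⟨hSF, hS, hle⟩, hmax⟩ : ∃ S, P S ∧ ∀ S', S ⊂ S' → ¬ P S' := by
    have hfin : {S | P S}.Finite := F.powerset.finite_toSet.subset fun S hS => by
      simpa using hS.1
    obtain ⟨S, hS⟩ := hfin.exists_maximal hP
    exact ⟨S, hS.1, fun S' h' hP' => h'.2 (hS.2 hP' h'.1)⟩
  by_cases hSF' : S = F
  · rw [← hSF']; exact hle
  exfalso
  have hnd : ¬ Disjoint (span K (x '' S)) (span K (x '' (F \ S : Finset ι))) :=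
    fun hd => h ⟨S, hSF, hS, hSF', hd⟩
  obtain ⟨T, hT, hTne, c, hc, hm, hm0, hr⟩ := exists_circuit_of_not_disjoint x S (F \ S) hnd
  have h1 := familyRank_union_add_le u v S T c hc hm
  have h2 : familyRank K v (S ∪ T) + 1 ≤ familyRank K v S + familyRank K v T := by
    have h3 := finrank_sup_add_finrank_inf_eq (span K (v '' S)) (span K (v '' T))
    rw [← span_union, ← Set.image_union, ← Finset.coe_union] at h3
    have h4 : 0 < finrank K (span K (v '' S) ⊓ span K (v '' T) : Submodule K V) := by
      refine Nat.pos_of_ne_zero fun h0 => ?_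
      rw [Submodule.finrank_eq_zero] at h0
      have hd := disjoint_span_smul u v (disjoint_iff.2 h0)
      exact hm0 (Submodule.disjoint_def.1 hd _ hm (sum_smul_mem_span_image x T c))
    simp only [familyRank]
    omega
  obtain ⟨t, ht⟩ := hTne
  have htS : t ∉ S := (Finset.mem_sdiff.1 (hT ht)).2
  refine hmax (S ∪ T) ?_ ⟨Finset.union_subset hSF (hT.trans Finset.sdiff_subset),
    hS.mono Finset.subset_union_left, by omega⟩
  exact Finset.ssubset_iff_subset_ne.2 ⟨Finset.subset_union_left, fun h0 =>
    htS (h0 ▸ Finset.mem_union_right _ ht)⟩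

/-- The three-factor version of `add_familyRank_le_of_not_splits`. -/
theorem add_add_familyRank_le_of_not_splits {α β γ : Type*} [Finite α] [Finite β] [Finite γ]
    (u : ι → α → K) (v : ι → β → K) (w : ι → γ → K) {F : Finset ι} (hF : F.Nonempty)
    (h : ¬ Splits K (fun a i j k => u a i * (v a j * w a k)) F) :
    familyRank K u F + familyRank K v F + familyRank K w F ≤
      familyRank K (fun a i j k => u a i * (v a j * w a k)) F + 2 := by
  have h1 := add_familyRank_le_of_not_splits u (fun a j k => v a j * w a k) hF h
  have h2 := add_familyRank_le_of_not_splits v w hF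
    (fun h' => h (Splits.smul u (v := fun a j k => v a j * w a k) h'))
  have h3 : familyRank K (fun a i => u a i • (fun j k => v a j * w a k)) F =
    familyRank K (fun a i j k => u a i * (v a j * w a k)) F := rfl
  have h4 : familyRank K (fun a i => v a i • w a) F =
    familyRank K (fun a j k => v a j * w a k) F := rfl
  omega

/-- A nonempty family with sum zero but no proper nonempty subfamily of sum zero does not split. -/
theorem not_splits_of_minimal_sum_eq_zero {x : ι → V} {F : Finset ι} (h : ∑ a ∈ F, x a = 0)
    (hmin : ∀ S ⊆ F, S.Nonempty → S ≠ F → ∑ a ∈ S, x a ≠ 0) : ¬ Splits K x F := by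
  rintro ⟨S, h1, h2, h3, h4⟩
  refine hmin S h1 h2 h3 (Submodule.disjoint_def.1 h4 _
    (sum_mem fun a ha => subset_span ⟨a, ha, rfl⟩) ?_)
  rw [← Finset.sum_sdiff h1] at h
  rw [eq_neg_of_add_eq_zero_right h]
  exact neg_mem (sum_mem fun a ha => subset_span ⟨a, ha, rfl⟩)

theorem familyRank_lt_card_of_sum_eq_zero [FiniteDimensional K V] {x : ι → V} {F : Finset ι} (hF : F.Nonempty)
    (h : ∑ a ∈ F, x a = 0) : familyRank K x F < F.card := by
  obtain ⟨t, ht⟩ := hF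
  have h1 : familyRank K x F ≤ familyRank K x (F.erase t) := by
    refine Submodule.finrank_mono (span_le.2 ?_)
    rintro _ ⟨a, ha, rfl⟩
    by_cases hat : a = t
    · subst hat
      rw [← Finset.add_sum_erase _ _ ht] at h
      rw [eq_neg_of_add_eq_zero_left h]
      exact neg_mem (sum_mem fun b hb => subset_span ⟨b, hb, rfl⟩)
    · exact subset_span ⟨a, by simpa [hat] using ha, rfl⟩
  have h2 := familyRank_le_card (K := K) x (F.erase t)
  have := Finset.card_erase_lt_of_mem ht
  omega

end Split

theorem min_card_le_familyRank_sumElim {K ι V : Type*} [Field K] [AddCommGroup V] [Module K V]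
    [FiniteDimensional K V] {f g : ι → V} {k : ℕ}
    (hf : ∀ S : Finset ι, min k S.card ≤ familyRank K f S) (F : Finset (ι ⊕ ι)) :
    min k F.toLeft.card ≤ familyRank K (Sum.elim f g) F := by
  refine (hf _).trans (Submodule.finrank_mono (span_mono ?_))
  rintro _ ⟨a, ha, rfl⟩
  exact ⟨Sum.inl a, by simpa using ha, rfl⟩

/-- **Kruskal's theorem** on the uniqueness of tensor decompositions. -/
theorem exists_perm_of_sum_eq {K ι α β γ : Type*} [Field K] [Fintype ι]
    [Finite α] [Finite β] [Finite γ]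
    (u u' : ι → α → K) (v v' : ι → β → K) (w w' : ι → γ → K) (k₁ k₂ k₃ : ℕ)
    (hne : ∀ a, (fun i j k => u a i * (v a j * w a k)) ≠ 0)
    (hu : ∀ S : Finset ι, min k₁ S.card ≤ familyRank K u S)
    (hv : ∀ S : Finset ι, min k₂ S.card ≤ familyRank K v S)
    (hw : ∀ S : Finset ι, min k₃ S.card ≤ familyRank K w S)
    (h₁ : k₁ ≤ Fintype.card ι) (h₂ : k₂ ≤ Fintype.card ι) (h₃ : k₃ ≤ Fintype.card ι)
    (hk : 2 ≤ Fintype.card ι → 2 * Fintype.card ι + 2 ≤ k₁ + k₂ + k₃)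
    (hsum : ∑ a, (fun i j k => u a i * (v a j * w a k)) =
      ∑ a, (fun i j k => u' a i * (v' a j * w' a k))) :
    ∃ σ : Equiv.Perm ι, ∀ a, (fun i j k => u' a i * (v' a j * w' a k)) =
      (fun i j k => u (σ a) i * (v (σ a) j * w (σ a) k)) := by
  classical
  let x : ι → α → β → γ → K := fun a i j k => u a i * (v a j * w a k)
  let y : ι → α → β → γ → K := fun a i j k => u' a i * (v' a j * w' a k)
  -- The sign is absorbed in the first factor, so that the difference of the two decompositions is a
  -- zero-sum family of product vectors.
  let U : ι ⊕ ι → α → K := Sum.elim u (-u')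
  let Q : ι ⊕ ι → β → K := Sum.elim v v'
  let W : ι ⊕ ι → γ → K := Sum.elim w w'
  let z : ι ⊕ ι → α → β → γ → K := fun a i j k => U a i * (Q a j * W a k)
  have hzl : ∀ a, z (Sum.inl a) = x a := fun a => rfl
  have hzr : ∀ a, z (Sum.inr a) = - y a := fun a => by
    funext i j k
    simp [z, U, Q, W, y]
  have hzsum : ∀ F : Finset (ι ⊕ ι), ∑ a ∈ F, z a =
      ∑ a ∈ F.toLeft, x a - ∑ a ∈ F.toRight, y a := by
    intro F
    conv_lhs => rw [← Finset.toLeft_disjSum_toRight (u := F)]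
    rw [Finset.sum_disjSum]
    simp only [hzl, hzr, Finset.sum_neg_distrib, sub_eq_add_neg]
  -- The inequality is part of the induction so that equality for `F` forces equality for both
  -- zero-sum pieces. Multisets allow repeated terms.
  have main : ∀ F : Finset (ι ⊕ ι), ∑ a ∈ F, z a = 0 → F.toLeft.card ≤ F.toRight.card ∧
      (F.toLeft.card = F.toRight.card → F.toLeft.val.map x = F.toRight.val.map y) := by
    intro F
    induction F using Finset.strongInduction with
    | H F ih =>
    intro hF0
    rcases F.eq_empty_or_nonempty with rfl | hFne
    · exact ⟨le_rfl, fun _ => rfl⟩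
    by_cases hmin : ∀ S ⊆ F, S.Nonempty → S ≠ F → ∑ a ∈ S, z a ≠ 0
    · have hns := not_splits_of_minimal_sum_eq_zero (K := K) hF0 hmin
      have hdim := add_add_familyRank_le_of_not_splits U Q W hFne hns
      have hlt := familyRank_lt_card_of_sum_eq_zero (K := K) hFne hF0
      have e1 := min_card_le_familyRank_sumElim (g := -u') hu F
      have e2 := min_card_le_familyRank_sumElim (g := v') hv F
      have e3 := min_card_le_familyRank_sumElim (g := w') hw F
      have hc := Finset.card_toLeft_add_card_toRight (u := F)
      have hcl : F.toLeft.card ≤ Fintype.card ι := Finset.card_le_univ _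
      have hpos := Finset.card_pos.2 hFne
      by_cases hlr : F.toLeft.card < F.toRight.card
      · exact ⟨hlr.le, fun h => absurd h hlr.ne⟩
      -- With `s` terms on the left and at most `s` on the right, the splitting inequality gives
      -- `min k₁ s + min k₂ s + min k₃ s ≤ 2 * s + 1`. For `s ≥ 2` this contradicts the bound on `k₁
      -- + k₂ + k₃`, as each `kᵢ` is at most the number of terms.
      have hs : F.toLeft.card = 1 := by
        change familyRank K U F + familyRank K Q F + familyRank K W F ≤
          familyRank K z F + 2 at hdim
        change _ ≤ familyRank K U F at e1
        change _ ≤ familyRank K Q F at e2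
        change _ ≤ familyRank K W F at e3
        by_contra hs
        have : 2 ≤ Fintype.card ι := by omega
        have := hk this
        omega
      obtain ⟨a, ha⟩ := Finset.card_eq_one.1 hs
      have hsz := hzsum F
      rw [hF0, ha, Finset.sum_singleton] at hsz
      have hr0 : F.toRight.card ≠ 0 := by
        intro h0
        rw [Finset.card_eq_zero] at h0
        rw [h0, Finset.sum_empty, sub_zero] at hsz
        exact hne a hsz.symm
      have hr1 : F.toRight.card = 1 := by omega
      obtain ⟨b, hb⟩ := Finset.card_eq_one.1 hr1
      rw [hb, Finset.sum_singleton] at hsz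
      refine ⟨by omega, fun _ => ?_⟩
      rw [ha, hb]
      simpa using (sub_eq_zero.1 hsz.symm)
    · push Not at hmin
      obtain ⟨S, hSF, hSne, hS, hS0⟩ := hmin
      have hD0 : ∑ a ∈ F \ S, z a = 0 := by
        rw [← Finset.sum_sdiff hSF, hS0, add_zero] at hF0
        exact hF0
      have i1 := ih S (Finset.ssubset_iff_subset_ne.2 ⟨hSF, hS⟩) hS0
      have i2 := ih (F \ S) (Finset.sdiff_ssubset hSF hSne) hD0
      have hl : F.toLeft.val = S.toLeft.val + (F \ S).toLeft.val := by
        rw [← Finset.disjUnion_val _ _ (by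
          rw [Finset.toLeft_sdiff]; exact Finset.disjoint_sdiff)]
        congr 1
        rw [Finset.disjUnion_eq_union, Finset.toLeft_sdiff, Finset.union_sdiff_of_subset]
        exact Finset.toLeft_subset_toLeft hSF
      have hr : F.toRight.val = S.toRight.val + (F \ S).toRight.val := by
        rw [← Finset.disjUnion_val _ _ (by
          rw [Finset.toRight_sdiff]; exact Finset.disjoint_sdiff)]
        congr 1
        rw [Finset.disjUnion_eq_union, Finset.toRight_sdiff, Finset.union_sdiff_of_subset]
        exact Finset.toRight_subset_toRight hSF
      have hl' := congrArg Multiset.card hl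
      have hr' := congrArg Multiset.card hr
      rw [Multiset.card_add] at hl' hr'
      simp only [Finset.card_val] at hl' hr'
      refine ⟨by omega, fun h => ?_⟩
      rw [hl, hr, Multiset.map_add, Multiset.map_add, i1.2 (by omega), i2.2 (by omega)]
  have hfin := main Finset.univ (by
    rw [hzsum]
    have e1 : (Finset.univ : Finset (ι ⊕ ι)).toLeft = Finset.univ := by ext; simp
    have e2 : (Finset.univ : Finset (ι ⊕ ι)).toRight = Finset.univ := by ext; simp
    rw [e1, e2, sub_eq_zero]
    exact hsum)
  have e1 : (Finset.univ : Finset (ι ⊕ ι)).toLeft = Finset.univ := by ext; simp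
  have e2 : (Finset.univ : Finset (ι ⊕ ι)).toRight = Finset.univ := by ext; simp
  rw [e1, e2] at hfin
  have hmap := hfin.2 rfl
  have hcard : ∀ c : α → β → γ → K, Fintype.card {a // y a = c} = Fintype.card {a // x a = c} := by
    intro c
    have := congrArg (Multiset.count c) hmap
    rw [Multiset.count_map, Multiset.count_map] at this
    rw [Fintype.card_subtype, Fintype.card_subtype, Finset.card_def, Finset.card_def,
      Finset.filter_val, Finset.filter_val]
    simp only [eq_comm (a := c)] at this
    exact this.symm
  let σ : Equiv.Perm ι := Equiv.ofFiberEquiv (f := y) (g := x)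
    fun c => Fintype.equivOfCardEq (hcard c)
  exact ⟨σ, fun a => (Equiv.ofFiberEquiv_map (f := y) (g := x) _ a).symm⟩

end

/-! ### Lifting generic points of the closure of an image -/

/-- An open set missing `η` misses its closure; the dichotomy survives unions and complements. Used
with Chevalley's theorem at the generic point of an image. -/
theorem Topology.IsConstructible.exists_isOpen_inter_closure_subset {X : Type*} [TopologicalSpace X]
    {C : Set X} (hC : Topology.IsConstructible C) (η : X) :
    ∃ U, IsOpen U ∧ η ∈ U ∧
      (U ∩ closure {η} ⊆ C ∨ U ∩ closure {η} ⊆ Cᶜ) := by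
  induction hC using Topology.IsConstructible.empty_union_induction with
  | open_retrocompact U hU _ =>
    by_cases h : η ∈ U
    · exact ⟨U, hU, h, Or.inl Set.inter_subset_left⟩
    · refine ⟨Set.univ, isOpen_univ, trivial, Or.inr fun x hx hxU => ?_⟩
      obtain ⟨y, hy, hy'⟩ := mem_closure_iff.1 hx.2 U hU hxU
      exact h (hy' ▸ hy)
  | union s hs t ht h1 h2 =>
    obtain ⟨U, hU, hηU, h1⟩ := h1
    obtain ⟨V, hV, hηV, h2⟩ := h2
    refine ⟨U ∩ V, hU.inter hV, ⟨hηU, hηV⟩, ?_⟩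
    rcases h1 with h1 | h1
    · exact Or.inl fun x hx => Or.inl (h1 ⟨hx.1.1, hx.2⟩)
    rcases h2 with h2 | h2
    · exact Or.inl fun x hx => Or.inr (h2 ⟨hx.1.2, hx.2⟩)
    · exact Or.inr fun x hx hst => hst.elim (h1 ⟨hx.1.1, hx.2⟩) (h2 ⟨hx.1.2, hx.2⟩)
  | compl s hs h =>
    obtain ⟨U, hU, hηU, h⟩ := h
    exact ⟨U, hU, hηU, by rw [compl_compl]; exact h.symm⟩

/-- A nontrivial algebra of finite type over a field has a point over any algebraically closed
extension field. -/
theorem Algebra.FiniteType.nonempty_algHom (K : Type*) {A L : Type*} [Field K] [CommRing A]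
    [Algebra K A] [Algebra.FiniteType K A] [Nontrivial A] [Field L] [Algebra K L]
    [IsAlgClosed L] : Nonempty (A →ₐ[K] L) := by
  obtain ⟨M, hM⟩ := Ideal.exists_maximal A
  let _ : Field (A ⧸ M) := Ideal.Quotient.field M
  have : Algebra.FiniteType K (A ⧸ M) :=
    Algebra.FiniteType.of_surjective (Ideal.Quotient.mkₐ K M)
      (Ideal.Quotient.mkₐ_surjective K M)
  have : Module.Finite K (A ⧸ M) := finite_of_finite_type_of_isJacobsonRing K (A ⧸ M)
  exact ⟨(IsAlgClosed.lift (R := K) (S := A ⧸ M) (M := L)).comp (Ideal.Quotient.mkₐ K M)⟩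

open MvPolynomial in
/-- The image of the locus `g ≠ 0` under a polynomial map `φ` contains a nonempty open subset of
the closure of the image of `φ`. -/
theorem exists_lift_of_mem_closure_of_ne_zero {K σ τ : Type*} [Field K] [Finite σ] [Finite τ]
    (φ : τ → MvPolynomial σ K) {g : MvPolynomial σ K} (hg : g ≠ 0) :
    ∃ f : MvPolynomial τ K, aeval φ f ≠ 0 ∧
      ∀ y : τ → K, (∀ p : MvPolynomial τ K, aeval φ p = 0 → aeval y p = 0) → aeval y f ≠ 0 →
        ∀ (L : Type*) [Field L] [Algebra K L] [IsAlgClosed L],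
          ∃ x : σ → L, (∀ j, aeval x (φ j) = algebraMap K L (y j)) ∧ aeval x g ≠ 0 := by
  let B := Localization.Away g
  have hinj : Function.Injective (algebraMap (MvPolynomial σ K) B) :=
    IsLocalization.injective B (Submonoid.powers_le.2 (mem_nonZeroDivisors_of_ne_zero hg))
  have hB : IsDomain B := IsLocalization.isDomain_localization
    (Submonoid.powers_le.2 (mem_nonZeroDivisors_of_ne_zero hg))
  have hfinB : Algebra.FiniteType K B :=
    Algebra.FiniteType.trans (S := MvPolynomial σ K) inferInstance
      (IsLocalization.finiteType_of_monoid_fg (Submonoid.powers g) B)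
  let Φ : MvPolynomial τ K →ₐ[K] B := (Algebra.algHom K (MvPolynomial σ K) B).comp (aeval φ)
  have hΦ0 : ∀ p, Φ p = 0 ↔ aeval φ p = 0 := fun p =>
    map_eq_zero_iff (algebraMap (MvPolynomial σ K) B) hinj
  have hΦ : Φ.toRingHom.FinitePresentation := by
    refine RingHom.FinitePresentation.of_finiteType.1 ?_
    refine RingHom.FiniteType.of_comp_finiteType (f := algebraMap K (MvPolynomial τ K)) ?_
    have : Φ.toRingHom.comp (algebraMap K (MvPolynomial τ K)) = algebraMap K B :=
      Φ.comp_algebraMap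
    rw [this]
    exact RingHom.finiteType_algebraMap.2 hfinB
  let η : PrimeSpectrum (MvPolynomial τ K) := PrimeSpectrum.comap Φ.toRingHom ⊥
  have hη : ∀ p, p ∈ η.asIdeal ↔ aeval φ p = 0 := fun p => hΦ0 p
  obtain ⟨U, hU, hηU, h⟩ := (PrimeSpectrum.isConstructible_range_comap
    hΦ).exists_isOpen_inter_closure_subset η
  -- The point `η` is the image of the zero ideal of `B`, so the second alternative is impossible.
  replace h := h.resolve_right fun h' => h' ⟨hηU, subset_closure rfl⟩ ⟨⊥, rfl⟩
  obtain ⟨_, ⟨f, rfl⟩, hf1, hf2⟩ :=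
    PrimeSpectrum.isTopologicalBasis_basic_opens.exists_subset_of_mem_open hηU hU
  refine ⟨f, fun h0 => hf1 ((hη f).2 h0), fun y hy hyf L _ _ _ => ?_⟩
  let m : PrimeSpectrum (MvPolynomial τ K) := pointToPoint y
  have hm : ∀ p, p ∈ m.asIdeal ↔ aeval y p = 0 := fun p => by
    change p ∈ vanishingIdeal K {y} ↔ _
    simp
  obtain ⟨q, hq⟩ := h (a := m) ⟨hf2 fun h' => hyf ((hm f).1 h'), by
    rw [← PrimeSpectrum.le_iff_mem_closure]
    exact fun p hp => (hm p).2 (hy p ((hη p).1 hp))⟩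
  -- An `L`-point of the fibre over `y`; as `g` is a unit in `B`, it is automatically nonzero there.
  obtain ⟨ψ⟩ := Algebra.FiniteType.nonempty_algHom K (A := B ⧸ q.asIdeal) (L := L)
  let χ : B →ₐ[K] L := ψ.comp (Ideal.Quotient.mkₐ K q.asIdeal)
  let x : σ → L := fun i => χ (algebraMap (MvPolynomial σ K) B (X i))
  have hx : ∀ p, aeval x p = χ (algebraMap (MvPolynomial σ K) B p) := by
    intro p
    have : aeval x = χ.comp (Algebra.algHom K (MvPolynomial σ K) B) := by
      refine algHom_ext fun i => ?_
      simp [x]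
      rfl
    rw [this]
    rfl
  refine ⟨x, fun j => ?_, ?_⟩
  · have h1 : X j - C (y j) ∈ m.asIdeal := (hm _).2 (by simp)
    rw [← hq] at h1
    have h2 : Φ (X j - C (y j)) ∈ q.asIdeal := h1
    have h3 : χ (Φ (X j - C (y j))) = 0 := by
      change ψ (Ideal.Quotient.mk _ _) = 0
      rw [Ideal.Quotient.eq_zero_iff_mem.2 h2, map_zero]
    rw [map_sub, map_sub, sub_eq_zero] at h3
    rw [hx]
    have h4 : Φ (X j) = algebraMap (MvPolynomial σ K) B (φ j) := by
      simp [Φ]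
      rfl
    rw [← h4, h3]
    exact (χ.comp Φ).commutes (y j)
  · rw [hx]
    exact ((IsLocalization.Away.algebraMap_isUnit g).map χ).ne_zero

/-! ### Permutations of a grid -/

section Grid
open Function

theorem apply_eq_of_forall_update {κ β : Type*} [Fintype κ] [DecidableEq κ] {α : κ → Type*}
    (f : (∀ k, α k) → β) (s : Set κ) (h : ∀ k ∉ s, ∀ i a, f (update i k a) = f i)
    {i j : ∀ k, α k} (hij : ∀ k ∈ s, i k = j k) : f i = f j := by
  have key : ∀ t : Finset κ, f (t.piecewise j i) = f i := by
    intro t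
    induction t using Finset.induction_on with
    | empty => simp
    | insert a t _ ih =>
      rw [Finset.piecewise_insert]
      by_cases ha : a ∈ s
      · rw [← ih]
        congr 1
        rw [update_eq_iff]
        exact ⟨by by_cases hat : a ∈ t <;> simp [hat, hij a ha], fun _ _ => rfl⟩
      · rw [h a ha, ih]
  simpa using (key Finset.univ).symm

/-- A permutation of a grid preserving the relation "the pairs of coordinates agree in every
direction" permutes the directions and the coordinates in each direction. -/
theorem exists_perm_of_preserves_pairs {m : ℕ} {r : Fin m → ℕ} (hr : ∀ k, 2 ≤ r k)
    (τ : Equiv.Perm (∀ k, Fin (r k)))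
    (hτ : ∀ i j i' j' : ∀ k, Fin (r k), (∀ k, s(i k, j k) = s(i' k, j' k)) →
      ∀ k, s(τ i k, τ j k) = s(τ i' k, τ j' k)) :
    ∃ (ψ : Equiv.Perm (Fin m)) (π : ∀ k, Fin (r k) ≃ Fin (r (ψ k))),
      ∀ i k, τ i (ψ k) = π k (i k) := by
  let i₀ : ∀ k, Fin (r k) := fun k => ⟨0, by have := hr k; omega⟩
  have other : ∀ k (a : Fin (r k)), ∃ b, b ≠ a := fun k a => by
    have : Nontrivial (Fin (r k)) := Fin.nontrivial_iff_two_le.2 (hr k)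
    exact exists_ne a
  -- Exchanging the `k`-th entries of `i` and `update j k a` preserves all unordered pairs. If
  -- output `l` changes, the output pair must match crosswise, so the outputs do not depend on the
  -- rest of `j`.
  have h1 : ∀ l k (i : ∀ k, Fin (r k)) (a : Fin (r k)), τ (update i k a) l ≠ τ i l → ∀ j,
      τ (update j k a) l = τ (update i k a) l ∧ τ (update j k (i k)) l = τ i l := by
    intro l k i a hne j
    have := hτ i (update j k a) (update i k a) (update j k (i k)) (by
      intro k'
      by_cases hk : k' = k
      · subst hk; simp [Sym2.eq_swap]
      · simp [hk]) l
    rw [Sym2.eq_iff] at this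
    rcases this with h | h
    · exact absurd h.1.symm hne
    · exact ⟨h.2, h.1.symm⟩
  -- By `h1`, fixing the `k`-th entry at `i k` fixes output `l`, so no other direction can affect
  -- it.
  have h2 : ∀ l k k' (i i' : ∀ k, Fin (r k)) a a', τ (update i k a) l ≠ τ i l →
      τ (update i' k' a') l ≠ τ i' l → k = k' := by
    intro l k k' i i' a a' hne hne'
    by_contra hk
    have e1 := (h1 l k i a hne (update (update i₀ k' (i' k')) k (i k))).2
    have e2 := (h1 l k i a hne (update (update i₀ k' a') k (i k))).2
    rw [update_idem] at e1 e2
    rw [update_comm (Ne.symm hk)] at e1 e2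
    have e3 := (h1 l k' i' a' hne' (update i₀ k (i k))).2
    have e4 := (h1 l k' i' a' hne' (update i₀ k (i k))).1
    exact hne' (by rw [← e3, ← e4, e1, e2])
  have h3 : ∀ l, ∃ k i, ∃ a : Fin (r k), τ (update i k a) l ≠ τ i l := by
    intro l
    by_contra hcon
    push Not at hcon
    obtain ⟨b, hb⟩ := other l (τ i₀ l)
    have := apply_eq_of_forall_update (fun i => τ i l) ∅ (fun k _ i a => hcon k i a)
      (i := i₀) (j := τ.symm (update i₀ l b)) (by simp)
    simp only [Equiv.apply_symm_apply, update_self] at this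
    exact hb this.symm
  choose κ hκ using h3
  have h4 : ∀ l (i j : ∀ k, Fin (r k)), i (κ l) = j (κ l) → τ i l = τ j l := by
    intro l i j hij
    refine apply_eq_of_forall_update (fun i => τ i l) {κ l} (fun k hk i a => ?_)
      (by simpa using hij)
    by_contra hne
    obtain ⟨i', a', h'⟩ := hκ l
    exact hk (h2 l k _ _ _ _ _ hne h')
  -- A direction controlling no output would contradict injectivity of `τ`, since it has at least
  -- two values.
  have h5 : Surjective κ := by
    intro k
    by_contra hcon
    push Not at hcon
    obtain ⟨b, hb⟩ := other k (i₀ k)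
    have : τ (update i₀ k b) = τ i₀ := by
      funext l
      exact h4 l _ _ (by simp [hcon l])
    have := congrFun (τ.injective this) k
    rw [update_self] at this
    exact hb this
  have h6 : Bijective κ := Finite.surjective_iff_bijective.1 h5
  let ψ : Equiv.Perm (Fin m) := (Equiv.ofBijective κ h6).symm
  have hψ : ∀ k, κ (ψ k) = k := (Equiv.ofBijective κ h6).apply_symm_apply
  have h7 : ∀ k (i j : ∀ k, Fin (r k)), i k = j k → τ i (ψ k) = τ j (ψ k) := by
    intro k i j hij
    refine h4 _ _ _ ?_
    rw [hψ]
    exact hij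
  have hbij : ∀ k, Bijective (fun a : Fin (r k) => τ (update i₀ k a) (ψ k)) := by
    refine fun k => ⟨fun a b hab => ?_, fun b => ?_⟩
    · have : τ (update i₀ k a) = τ (update i₀ k b) := by
        funext l
        by_cases hl : κ l = k
        · have : l = ψ k := h6.1 (by rw [hψ, hl])
          rw [this]
          exact hab
        · exact h4 l _ _ (by simp [hl])
      simpa using congrFun (τ.injective this) k
    · refine ⟨τ.symm (update i₀ (ψ k) b) k, ?_⟩
      have := h7 k (update i₀ k (τ.symm (update i₀ (ψ k) b) k)) (τ.symm (update i₀ (ψ k) b))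
        (by simp)
      simpa using this
  exact ⟨ψ, fun k => Equiv.ofBijective _ (hbij k), fun i k => h7 k _ _ (by simp)⟩

end Grid

/-! ### Essential decompositions in terms of ordered families -/

namespace HHD

section Orbit
variable {K : Type*} [Field K] {d m : ℕ} {n : Fin d → ℕ} {r : Fin m → ℕ}

theorem outer_mul (a b : ∀ i : Fin d, Fin (n i) → K) : outer a * outer b = outer (a * b) := by
  funext j
  simp [outer, Finset.prod_mul_distrib]

theorem outer_inv (a : ∀ i : Fin d, Fin (n i) → K) : (outer a)⁻¹ = outer a⁻¹ := by
  funext j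
  simp [outer]

theorem segreStar_of_segre {A B : Tensor K n} (hA : A ∈ segre K n) (hB : B ∈ segre K n)
    (hA' : ∀ j, A j ≠ 0) (hB' : ∀ j, B j ≠ 0) : A * B⁻¹ ∈ segreStar K n := by
  have h0 : ∀ j, (A * B⁻¹) j ≠ 0 := fun j => mul_ne_zero (hA' j) (inv_ne_zero (hB' j))
  obtain ⟨hA0, a, rfl⟩ := hA
  obtain ⟨hB0, b, rfl⟩ := hB
  obtain ⟨j, -⟩ := Function.ne_iff.1 hA0
  exact ⟨⟨fun h => h0 j (congrFun h j), a * b⁻¹, by rw [outer_inv, outer_mul]⟩, h0⟩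

theorem inv_mem_segreStar {A : Tensor K n} (hA : A ∈ segreStar K n) : A⁻¹ ∈ segreStar K n := by
  obtain ⟨⟨hA0, a, rfl⟩, h⟩ := hA
  obtain ⟨j, hj⟩ := Function.ne_iff.1 hA0
  exact ⟨⟨fun h' => inv_ne_zero hj (congrFun h' j), a⁻¹, outer_inv a⟩,
    fun j => inv_ne_zero (h j)⟩

theorem mul_mem_segreStar {A B : Tensor K n} (hA : A ∈ segreStar K n) (hB : B ∈ segreStar K n) :
    A * B ∈ segreStar K n := by
  have := inv_mem_segreStar hB
  have h := segreStar_of_segre hA.1 this.1 hA.2 this.2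
  rwa [inv_inv] at h

/-- `B` arises from `A` by reordering and by Hadamard multiplication of the factors by tensors
in `S*` with product `1`. -/
def StarEquiv (A B : Family K n r) : Prop :=
  ∃ (ψ : Equiv.Perm (Fin m)) (π : ∀ k, Fin (r k) ≃ Fin (r (ψ k))) (D : Fin m → Tensor K n),
    (∀ k, D k ∈ segreStar K n) ∧ ∏ k, D k = 1 ∧ ∀ k i, B k i = D k * A (ψ k) (π k i)

theorem StarEquiv.trans {A B C : Family K n r} (h : StarEquiv A B) (h' : StarEquiv B C) :
    StarEquiv A C := by
  obtain ⟨ψ, π, D, hD, hD1, h⟩ := h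
  obtain ⟨ψ', π', D', hD', hD1', h'⟩ := h'
  refine ⟨ψ'.trans ψ, fun k => (π' k).trans (π (ψ' k)), fun k => D' k * D (ψ' k),
    fun k => mul_mem_segreStar (hD' k) (hD _), ?_, fun k i => ?_⟩
  · rw [Finset.prod_mul_distrib, hD1', Equiv.prod_comp ψ' D, hD1, one_mul]
  · rw [h', h, mul_assoc]
    rfl

theorem StarEquiv.symm {A B : Family K n r} (h : StarEquiv A B) : StarEquiv B A := by
  obtain ⟨ψ, π, D, hD, hD1, h⟩ := h
  obtain ⟨ψ', π', h'⟩ := (permSetoid K n r).symm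
    (⟨ψ, π, fun k i => rfl⟩ : (permSetoid K n r).r A (fun k i => A (ψ k) (π k i)))
  refine ⟨ψ', π', fun k => (D (ψ' k))⁻¹, fun k => inv_mem_segreStar (hD _), ?_, fun k i => ?_⟩
  · rw [Finset.prod_inv_distrib, Equiv.prod_comp ψ' D, hD1, inv_one]
  · rw [h', h]
    funext j
    simp [(hD (ψ' k)).2 j]

/-- The reorderings before and after scaling merge into one, so orbits can be handled on ordered
representatives. -/
theorem mem_starOrbit_iff {A B : Family K n r} :
    B.toUnordered ∈ starOrbit A.toUnordered ↔ StarEquiv A B := by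
  constructor
  · rintro ⟨A₁, D, h1, hD, hD1, h2⟩
    obtain ⟨ψ, π, h1⟩ := Quotient.exact h1.symm
    obtain ⟨ψ', π', h2⟩ := Quotient.exact h2.symm
    refine ⟨ψ'.trans ψ, fun k => (π' k).trans (π (ψ' k)), fun k => D (ψ' k),
      fun k => hD _, ?_, fun k i => ?_⟩
    · rw [Equiv.prod_comp ψ' D, hD1]
    · rw [h2]
      exact congrArg (D (ψ' k) * ·) (h1 _ _)
  · rintro ⟨ψ, π, D, hD, hD1, h⟩
    refine ⟨fun k i => A (ψ k) (π k i), D, ?_, hD, hD1, ?_⟩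
    · exact Quotient.sound ((permSetoid K n r).symm ⟨ψ, π, fun k i => rfl⟩)
    · exact congrArg Family.toUnordered (funext fun k => funext fun i => h k i)

theorem StarEquiv.starOrbit_eq {A B : Family K n r} (h : StarEquiv A B) :
    starOrbit A.toUnordered = starOrbit B.toUnordered := by
  ext H
  obtain ⟨C, rfl⟩ := Quotient.exists_rep H
  exact (mem_starOrbit_iff (B := C)).trans
    (Iff.trans ⟨fun h' => h.symm.trans h', fun h' => h.trans h'⟩ mem_starOrbit_iff.symm)

theorem identifiable_of_forall_starEquiv {T : Tensor K n} {A : Family K n r} (hA : IsHHD A T)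
    (h : ∀ B : Family K n r, IsHHD B T → StarEquiv A B) : Identifiable r T := by
  refine ⟨starOrbit A.toUnordered, Set.eq_singleton_iff_unique_mem.2
    ⟨⟨_, ⟨A, hA, rfl⟩, rfl⟩, ?_⟩⟩
  rintro _ ⟨_, ⟨B, hB, rfl⟩, rfl⟩
  exact (h B hB).starOrbit_eq.symm

/-- Two families whose expansions agree up to a structured permutation of the multi-indices are
related by reordering and rescaling. -/
theorem starEquiv_of_prod_eq (hr : ∀ k, 2 ≤ r k) {A B : Family K n r}
    (hA : ∀ k i, A k i ∈ segre K n) (hB : ∀ k i, B k i ∈ segre K n)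
    (hA0 : ∀ k i j, A k i j ≠ 0) (τ : Equiv.Perm (∀ k, Fin (r k)))
    (hτ : ∀ i : ∀ k, Fin (r k), ∏ k, B k (i k) = ∏ k, A k (τ i k))
    (ψ : Equiv.Perm (Fin m)) (π : ∀ k, Fin (r k) ≃ Fin (r (ψ k)))
    (hψ : ∀ i k, τ i (ψ k) = π k (i k)) : StarEquiv A B := by
  let i₀ : ∀ k, Fin (r k) := fun k => ⟨0, by have := hr k; omega⟩
  let A₁ : Family K n r := fun k i => A (ψ k) (π k i)
  have hprod : ∀ i : ∀ k, Fin (r k), ∏ k, B k (i k) = ∏ k, A₁ k (i k) := by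
    intro i
    rw [hτ, ← Equiv.prod_comp ψ]
    simp only [hψ, A₁]
  have hprod' : ∀ (i : ∀ k, Fin (r k)) j, ∏ k, B k (i k) j = ∏ k, A₁ k (i k) j := by
    intro i j
    have := congrFun (hprod i) j
    simpa [Finset.prod_apply] using this
  have hA₁ : ∀ k i j, A₁ k i j ≠ 0 := fun k i j => hA0 _ _ _
  have hB0 : ∀ k i j, B k i j ≠ 0 := by
    intro k i j h0
    have := hprod' (Function.update i₀ k i) j
    rw [Finset.prod_eq_zero (Finset.mem_univ k) (by simpa using h0)] at this
    exact Finset.prod_ne_zero_iff.2 (fun k _ => hA₁ _ _ _) this.symm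
  -- The scalings are read off at the base multi-index `i₀`, where equality of the expansions makes
  -- their product `1`. Changing only the `k`-th entry of `i₀` and cancelling the other factors
  -- gives the remaining relations.
  refine ⟨ψ, π, fun k => B k (i₀ k) * (A₁ k (i₀ k))⁻¹,
    fun k => segreStar_of_segre (hB _ _) (hA _ _) (hB0 _ _) (hA₁ _ _), ?_, fun k i => ?_⟩
  · rw [Finset.prod_mul_distrib, hprod, Finset.prod_inv_distrib]
    funext j
    have : (∏ k, A₁ k (i₀ k)) j ≠ 0 := by
      rw [Finset.prod_apply]
      exact Finset.prod_ne_zero_iff.2 fun k _ => hA₁ _ _ _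
    exact mul_inv_cancel₀ this
  · funext j
    have e1 := hprod' (Function.update i₀ k i) j
    have e2 := hprod' i₀ j
    rw [← Finset.mul_prod_erase _ _ (Finset.mem_univ k),
      ← Finset.mul_prod_erase _ _ (Finset.mem_univ k)] at e1 e2
    have e3 : ∀ C : Family K n r, ∏ l ∈ Finset.univ.erase k, C l (Function.update i₀ k i l) j =
        ∏ l ∈ Finset.univ.erase k, C l (i₀ l) j := by
      intro C
      refine Finset.prod_congr rfl fun l hl => ?_
      rw [Function.update_of_ne (Finset.ne_of_mem_erase hl)]
    rw [e3, e3, Function.update_self] at e1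
    have hP : ∏ l ∈ Finset.univ.erase k, B l (i₀ l) j ≠ 0 :=
      Finset.prod_ne_zero_iff.2 fun k _ => hB0 _ _ _
    have hA00 := hA₁ k (i₀ k) j
    change B k i j = B k (i₀ k) j * (A₁ k (i₀ k) j)⁻¹ * A₁ k i j
    field_simp
    refine mul_right_cancel₀ hP ?_
    linear_combination A₁ k (i₀ k) j * e1 - A₁ k i j * e2

end Orbit
end HHD

/-! ### Properties of generic points and of generic families -/

section
open MvPolynomial

universe u

/-- The property `P` of points with coordinates in field extensions of `K` holds on the complement
of some hypersurface defined over `K`. -/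
def HoldsGenerically (K : Type u) [Field K] {σ : Type*}
    (P : ∀ (L : Type u) [Field L] [Algebra K L], (σ → L) → Prop) : Prop :=
  ∃ g : MvPolynomial σ K, g ≠ 0 ∧
    ∀ (L : Type u) [Field L] [Algebra K L] (p : σ → L), aeval p g ≠ 0 → P L p

section Generic
variable {K : Type u} [Field K] {σ : Type*}

theorem holdsGenerically_aeval_ne_zero {g : MvPolynomial σ K} (hg : g ≠ 0) :
    HoldsGenerically K (fun _ _ _ (p : σ → _) => aeval p g ≠ 0) :=
  ⟨g, hg, fun _ _ _ _ h => h⟩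

theorem HoldsGenerically.mono {P Q : ∀ (L : Type u) [Field L] [Algebra K L], (σ → L) → Prop}
    (h : HoldsGenerically K P)
    (hPQ : ∀ (L : Type u) [Field L] [Algebra K L] (p : σ → L), P L p → Q L p) :
    HoldsGenerically K Q := by
  obtain ⟨g, hg, h⟩ := h
  exact ⟨g, hg, fun L _ _ p hp => hPQ L p (h L p hp)⟩

theorem HoldsGenerically.and {P Q : ∀ (L : Type u) [Field L] [Algebra K L], (σ → L) → Prop}
    (hP : HoldsGenerically K P) (hQ : HoldsGenerically K Q) :
    HoldsGenerically K (fun L _ _ p => P L p ∧ Q L p) := by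
  obtain ⟨g, hg, hP⟩ := hP
  obtain ⟨g', hg', hQ⟩ := hQ
  refine ⟨g * g', mul_ne_zero hg hg', fun L _ _ p h => ?_⟩
  rw [map_mul] at h
  exact ⟨hP L p (left_ne_zero_of_mul h), hQ L p (right_ne_zero_of_mul h)⟩

theorem holdsGenerically_forall {κ : Type*} [Finite κ]
    {P : κ → ∀ (L : Type u) [Field L] [Algebra K L], (σ → L) → Prop}
    (h : ∀ a, HoldsGenerically K (P a)) :
    HoldsGenerically K (fun L _ _ p => ∀ a, P a L p) := by
  have := Fintype.ofFinite κ
  choose g hg h using h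
  refine ⟨∏ a, g a, Finset.prod_ne_zero_iff.2 fun a _ => hg a, fun L _ _ p hp a => ?_⟩
  rw [map_prod] at hp
  exact h a L p (Finset.prod_ne_zero_iff.1 hp a (Finset.mem_univ a))

end Generic

section KRank
open Module

/-- If every `k` members of a family are linearly independent, then its Kruskal rank is at
least `k`. -/
theorem min_card_le_familyRank {L ι V : Type*} [Field L] [AddCommGroup V] [Module L V]
    [FiniteDimensional L V] [Fintype ι] {f : ι → V} {k : ℕ} (hk : k ≤ Fintype.card ι)
    (h : ∀ s : Fin k ↪ ι, LinearIndependent L (f ∘ s)) (S : Finset ι) :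
    min k S.card ≤ familyRank L f S := by
  classical
  have hT : ∀ T : Finset ι, T.card = k → LinearIndependent L (fun a : T => f a) := by
    intro T hT
    let e := T.equivFinOfCardEq hT
    have := h (e.symm.toEmbedding.trans (Function.Embedding.subtype _))
    have h2 := this.comp e e.injective
    convert h2 using 1
    funext a
    simp
  rcases le_total S.card k with hS | hS
  · obtain ⟨T, hST, hTk⟩ := Finset.exists_superset_card_eq hS hk
    have h1 := (hT T hTk).comp (fun a : S => (⟨a, hST a.2⟩ : T)) fun a b hab =>
      Subtype.ext (Subtype.mk.inj hab)
    rw [familyRank_eq_card (x := f) (S := S) h1]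
    exact min_le_right _ _
  · obtain ⟨T, hTS, hTk⟩ := Finset.exists_subset_card_eq hS
    have h1 := familyRank_eq_card (hT T hTk)
    have h2 := familyRank_mono (K := L) f hTS
    omega

theorem linearIndependent_of_det_ne_zero {L β : Type*} [Field L] {k : ℕ}
    {f : Fin k → β → L} (c : Fin k → β)
    (h : (Matrix.of fun a b => f a (c b)).det ≠ 0) : LinearIndependent L f := by
  have h1 := Matrix.linearIndependent_rows_of_det_ne_zero h
  exact LinearIndependent.of_comp (LinearMap.funLeft L L c) h1

end KRank

namespace HHD

/-- Mixed-radix expansions. -/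
theorem exists_weights {d : ℕ} {n : Fin d → ℕ} (hn : ∀ x, 0 < n x) (X : Finset (Fin d)) :
    ∃ w : Fin d → ℕ, ∀ t < dimProd n X, ∃ j : ∀ x, Fin (n x), ∑ x ∈ X, w x * j x = t := by
  induction X using Finset.induction_on with
  | empty =>
    refine ⟨0, fun t ht => ⟨fun x => ⟨0, hn x⟩, ?_⟩⟩
    simp [dimProd] at ht
    simp [ht]
  | insert y X hy ih =>
    obtain ⟨w, hw⟩ := ih
    refine ⟨Function.update w y (dimProd n X), fun t ht => ?_⟩
    rw [dimProd, Finset.prod_insert hy] at ht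
    change t < n y * dimProd n X at ht
    have hpos : 0 < dimProd n X := Finset.prod_pos fun x _ => hn x
    obtain ⟨j, hj⟩ := hw (t % dimProd n X) (Nat.mod_lt _ hpos)
    refine ⟨Function.update j y ⟨t / dimProd n X, (Nat.div_lt_iff_lt_mul hpos).2 ht⟩, ?_⟩
    rw [Finset.sum_insert hy]
    have : ∑ x ∈ X, Function.update w y (dimProd n X) x *
        (Function.update j y ⟨t / dimProd n X, (Nat.div_lt_iff_lt_mul hpos).2 ht⟩ x : ℕ) =
        ∑ x ∈ X, w x * j x := by
      refine Finset.sum_congr rfl fun x hx => ?_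
      have hxy : x ≠ y := fun h => hy (h ▸ hx)
      simp [hxy]
    rw [this, hj]
    simp [Nat.div_add_mod]

/-- The coordinates on the space of families of decomposable tensors. -/
abbrev Param {d m : ℕ} (n : Fin d → ℕ) (r : Fin m → ℕ) : Type :=
  Σ k : Fin m, Fin (r k) × Σ x : Fin d, Fin (n x)

variable {d m : ℕ} {n : Fin d → ℕ} {r : Fin m → ℕ}

/-- The family of decomposable tensors with given coordinates. -/
def paramFamily {L : Type*} [Field L] (p : Param n r → L) : Family L n r :=
  fun k i => outer fun x j => p ⟨k, i, x, j⟩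

/-- The part, indexed by the modes in `X`, of the Hadamard product of the decomposable tensors
selected by the multi-index `i`. -/
def modeVec {L : Type*} [CommRing L] (X : Finset (Fin d)) (p : Param n r → L)
    (i : ∀ k, Fin (r k)) : Tensor L n :=
  fun j => ∏ x ∈ X, ∏ k, p ⟨k, i k, x, j x⟩

/-- The entries of the Hadamard product of the sums, as polynomials in the coordinates. -/
noncomputable def hhdPoly (K : Type*) [Field K] (n : Fin d → ℕ) (r : Fin m → ℕ)
    (j : ∀ x, Fin (n x)) : MvPolynomial (Param n r) K :=
  ∏ k, ∑ i, ∏ x, MvPolynomial.X ⟨k, i, x, j x⟩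

section
variable {K L : Type*} [Field K] [Field L] [Algebra K L]

theorem aeval_hhdPoly (p : Param n r → L) (j : ∀ x, Fin (n x)) :
    aeval p (hhdPoly K n r j) = (∏ k, ∑ i, paramFamily p k i) j := by
  simp [hhdPoly, paramFamily, outer, Finset.prod_apply]

theorem aeval_modeVec (X : Finset (Fin d)) (p : Param n r → L) (i : ∀ k, Fin (r k))
    (j : ∀ x, Fin (n x)) :
    aeval p (modeVec X (MvPolynomial.X : _ → MvPolynomial (Param n r) K) i j) =
      modeVec X p i j := by
  simp [modeVec]

theorem prod_paramFamily_apply (p : Param n r → L) (i : ∀ k, Fin (r k)) (j : ∀ x, Fin (n x)) :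
    (∏ k, paramFamily p k (i k)) j = modeVec Finset.univ p i j := by
  simp only [paramFamily, outer, Finset.prod_apply, modeVec]
  exact Finset.prod_comm

theorem modeVec_congr {X : Finset (Fin d)} (p : Param n r → L) (i : ∀ k, Fin (r k))
    {j j' : ∀ x, Fin (n x)} (h : ∀ x ∈ X, j x = j' x) : modeVec X p i j = modeVec X p i j' :=
  Finset.prod_congr rfl fun x hx => by rw [h x hx]

theorem modeVec_union {X Y : Finset (Fin d)} (h : Disjoint X Y) (p : Param n r → L)
    (i : ∀ k, Fin (r k)) (j : ∀ x, Fin (n x)) :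
    modeVec (X ∪ Y) p i j = modeVec X p i j * modeVec Y p i j :=
  Finset.prod_union h

end

section
variable {K : Type u} [Field K] [CharZero K]

-- Exponents multiply the mixed-radix digits of `i` with `w x * j x`; summing over factors and modes
-- yields the product of the two codes. This point witnesses maximal Kruskal rank.
omit [CharZero K] in
variable (K) in
theorem exists_modeVec_eq_vandermonde (X : Finset (Fin d)) (w : Fin d → ℕ) :
    ∃ p : Param n r → K, ∀ i j,
      modeVec X p i j = ((2 : K) ^ (finPiFinEquiv i : ℕ)) ^ (∑ x ∈ X, w x * (j x : ℕ)) := by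
  refine ⟨fun q => 2 ^ ((q.2.1 * ∏ l : Fin q.1, r (Fin.castLE q.1.is_lt.le l)) *
    (w q.2.2.1 * q.2.2.2) : ℕ), fun i j => ?_⟩
  rw [← pow_mul, finPiFinEquiv_apply, Finset.sum_mul_sum, Finset.sum_comm]
  simp only [modeVec, Finset.prod_pow_eq_pow_sum]

omit [CharZero K] in
theorem aeval_det_modeVec {L : Type*} [Field L] [Algebra K L] (X : Finset (Fin d)) {k : ℕ}
    (s : Fin k → ∀ k, Fin (r k)) (c : Fin k → ∀ x, Fin (n x)) (p : Param n r → L) :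
    aeval p (Matrix.of fun a b => modeVec X (MvPolynomial.X : _ → MvPolynomial (Param n r) K)
      (s a) (c b)).det = (Matrix.of fun a b => modeVec X p (s a) (c b)).det := by
  rw [AlgHom.map_det]
  congr 1
  ext a b
  exact aeval_modeVec X p _ _

/-- At the special point the determinant is Vandermonde with nodes powers of `2`, distinct because
the characteristic is zero. -/
theorem det_modeVec_ne_zero (X : Finset (Fin d)) {k : ℕ}
    {s : Fin k → ∀ k, Fin (r k)} (hs : Function.Injective s) {w : Fin d → ℕ}
    {c : Fin k → ∀ x, Fin (n x)} (hc : ∀ b : Fin k, ∑ x ∈ X, w x * (c b x : ℕ) = b) :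
    (Matrix.of fun a b => modeVec X (MvPolynomial.X : _ → MvPolynomial (Param n r) K)
      (s a) (c b)).det ≠ 0 := by
  intro h0
  obtain ⟨p₀, hp₀⟩ := exists_modeVec_eq_vandermonde (n := n) (r := r) K X w
  have h1 := aeval_det_modeVec (K := K) X s c p₀
  rw [h0, map_zero] at h1
  have h2 : (Matrix.of fun a b => modeVec X p₀ (s a) (c b)) =
      Matrix.vandermonde fun a => (2 : K) ^ (finPiFinEquiv (s a) : ℕ) := by
    ext a b
    rw [Matrix.vandermonde_apply, Matrix.of_apply, hp₀, hc b]
  rw [h2] at h1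
  refine Matrix.det_vandermonde_ne_zero_iff.2 ?_ h1.symm
  intro a b hab
  have hab' : (2 : K) ^ (finPiFinEquiv (s a) : ℕ) = 2 ^ (finPiFinEquiv (s b) : ℕ) := hab
  have h3 : (2 : ℕ) ^ (finPiFinEquiv (s a) : ℕ) = 2 ^ (finPiFinEquiv (s b) : ℕ) := by
    exact_mod_cast hab'
  exact hs (finPiFinEquiv.injective (Fin.ext (Nat.pow_right_injective le_rfl h3)))

/-- A generic family has maximal Kruskal rank in every group of modes. -/
theorem holdsGenerically_min_card_le_familyRank (hn : ∀ x, 0 < n x) (X : Finset (Fin d)) {k : ℕ}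
    (hk : k ≤ Fintype.card (∀ k, Fin (r k))) (hkX : k ≤ dimProd n X) :
    HoldsGenerically K (fun L _ _ (p : Param n r → L) =>
      ∀ S : Finset (∀ k, Fin (r k)), min k S.card ≤ familyRank L (modeVec X p) S) := by
  obtain ⟨w, hw⟩ := exists_weights hn X
  choose c hc using fun b : Fin k => hw b (b.2.trans_le hkX)
  have h1 : HoldsGenerically K (fun L _ _ (p : Param n r → L) =>
      ∀ s : Fin k ↪ ∀ k, Fin (r k), LinearIndependent L fun a => modeVec X p (s a)) := by
    refine holdsGenerically_forall fun s => ?_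
    refine (holdsGenerically_aeval_ne_zero
      (det_modeVec_ne_zero (K := K) X s.injective hc)).mono ?_
    intro L _ _ p hp
    rw [aeval_det_modeVec] at hp
    exact linearIndependent_of_det_ne_zero c hp
  exact h1.mono fun L _ _ p hp S => min_card_le_familyRank hk hp S

/-- Both sides are `2` to the multiplicity of `a` in the pair, and `1`, `2`, `4` are distinct in
characteristic zero. -/
theorem sym2_eq_of_forall_ite {β : Type*} [DecidableEq β] {i j i' j' : β}
    (h : ∀ a, (if i = a then (2 : K) else 1) * (if j = a then 2 else 1) =
      (if i' = a then 2 else 1) * (if j' = a then 2 else 1)) : s(i, j) = s(i', j') := by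
  have h1 := h i
  have h2 := h j
  rw [Sym2.eq_iff]
  by_cases a1 : i = j <;> by_cases a2 : i' = i <;> by_cases a3 : j' = i <;>
    by_cases a4 : i' = j <;> by_cases a5 : j' = j <;> (simp_all; try norm_num at *)

/-- In a generic family, the only equalities between products of two of the Hadamard products are
the obvious ones. -/
theorem holdsGenerically_pairs (hn : ∀ x, 0 < n x) (x₀ : Fin d) :
    HoldsGenerically K (fun L _ _ (p : Param n r → L) => ∀ i j i' j' : ∀ k, Fin (r k),
      modeVec Finset.univ p i * modeVec Finset.univ p j =
        modeVec Finset.univ p i' * modeVec Finset.univ p j' →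
      ∀ k, s(i k, j k) = s(i' k, j' k)) := by
  refine holdsGenerically_forall fun i => holdsGenerically_forall fun j =>
    holdsGenerically_forall fun i' => holdsGenerically_forall fun j' => ?_
  by_cases hs : ∀ k, s(i k, j k) = s(i' k, j' k)
  · exact ⟨1, one_ne_zero, fun _ _ _ _ _ _ => hs⟩
  push Not at hs
  obtain ⟨k, hk⟩ := hs
  have h1 := mt (sym2_eq_of_forall_ite (K := K)) hk
  push Not at h1
  obtain ⟨a, ha⟩ := h1
  let c : ∀ x, Fin (n x) := fun x => ⟨0, hn x⟩
  let M : (∀ k, Fin (r k)) → MvPolynomial (Param n r) K := fun i =>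
    modeVec Finset.univ MvPolynomial.X i c
  have hM : M i * M j - M i' * M j' ≠ 0 := by
    -- All coordinates are `1` except those of mode `x₀` in summand `a` of factor `k`; each term of
    -- the expansion thus detects whether its `k`-th index is `a`.
    let p₀ : Param n r → K := fun q => if q.2.2.1 = x₀ then
      (if (⟨q.1, q.2.1⟩ : Σ k, Fin (r k)) = ⟨k, a⟩ then 2 else 1) else 1
    have h2 : ∀ i, aeval p₀ (M i) = if i k = a then 2 else 1 := by
      intro i
      rw [aeval_modeVec, modeVec, Finset.prod_eq_single x₀, Finset.prod_eq_single k]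
      · simp [p₀]
      · intro k' _ hk'
        simp [p₀, hk']
      · simp
      · intro x _ hx
        simp [p₀, hx]
      · simp
    intro h0
    have h3 := congrArg (aeval p₀) h0
    rw [map_sub, map_mul, map_mul, map_zero, sub_eq_zero] at h3
    simp only [h2] at h3
    exact ha h3
  refine (holdsGenerically_aeval_ne_zero hM).mono fun L _ _ p hp heq => absurd ?_ hp
  rw [map_sub, map_mul, map_mul, sub_eq_zero]
  simp only [M, aeval_modeVec]
  exact congrFun heq c

end
end HHD

end

/-! ### From generic families to identifiability -/

section
open MvPolynomial

universe u

namespace HHD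

variable {d m : ℕ} {n : Fin d → ℕ} {r : Fin m → ℕ}

theorem card_multiIndex (r : Fin m → ℕ) : Fintype.card (∀ k, Fin (r k)) = ∏ k, r k := by
  simp

/-- The genericity conditions on a family that guarantee identifiability. -/
structure IsGeneric {L : Type*} [Field L] (I J K : Finset (Fin d)) (p : Param n r → L) :
    Prop where
  ne_zero : ∀ q, p q ≠ 0
  rank_left : ∀ S : Finset (∀ k, Fin (r k)),
    min (min (∏ k, r k) (dimProd n I)) S.card ≤ familyRank L (modeVec I p) S
  rank_mid : ∀ S : Finset (∀ k, Fin (r k)),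
    min (min (∏ k, r k) (dimProd n J)) S.card ≤ familyRank L (modeVec J p) S
  rank_right : ∀ S : Finset (∀ k, Fin (r k)),
    min (min (∏ k, r k) (dimProd n K)) S.card ≤ familyRank L (modeVec K p) S
  pairs : ∀ i j i' j' : ∀ k, Fin (r k),
    modeVec Finset.univ p i * modeVec Finset.univ p j =
        modeVec Finset.univ p i' * modeVec Finset.univ p j' →
      ∀ k, s(i k, j k) = s(i' k, j' k)

theorem holdsGenerically_isGeneric (K : Type u) [Field K] [CharZero K] (hn : ∀ x, 0 < n x)
    (x₀ : Fin d) (I J M : Finset (Fin d)) :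
    HoldsGenerically K (fun L _ _ (p : Param n r → L) => IsGeneric I J M p) := by
  have h0 : HoldsGenerically K (fun L _ _ (p : Param n r → L) => ∀ q, p q ≠ 0) :=
    holdsGenerically_forall fun q =>
      (holdsGenerically_aeval_ne_zero (X_ne_zero (R := K) q)).mono fun L _ _ p hp => by
        simpa using hp
  have h1 := fun Y : Finset (Fin d) => holdsGenerically_min_card_le_familyRank (K := K) (r := r)
    hn Y (k := min (∏ k, r k) (dimProd n Y)) ((min_le_left _ _).trans (card_multiIndex r).ge)
    (min_le_right _ _)
  refine (h0.and ((h1 I).and ((h1 J).and ((h1 M).and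
    (holdsGenerically_pairs (K := K) hn x₀))))).mono ?_
  rintro L _ _ p ⟨e0, e1, e2, e3, e4⟩
  exact ⟨e0, e1, e2, e3, e4⟩

/-- The `δ / 2` branch gives `2 * N + 2 ≤ a + b + c` and the `δ` branch `N + 2 ≤ b + c`, for the
cases where no minimum, or only the first, is truncated to `N`. The others use `2 ≤ c` and `2 ≤ N`.
-/
theorem two_mul_add_two_le {N a b c : ℕ} (hba : b ≤ a) (hcb : c ≤ b) (hc : 2 ≤ c) (hN : 2 ≤ N)
    (h : (N : ℚ) ≤ (a : ℚ) + min (((b : ℚ) + c - a - 2) / 2) ((b : ℚ) + c - a - 2)) :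
    2 * N + 2 ≤ min N a + min N b + min N c := by
  have h1 : 2 * N + 2 ≤ a + b + c := by
    have := h.trans (add_le_add_right (min_le_left _ _) _)
    have h2 : (2 * N + 2 : ℚ) ≤ a + b + c := by linarith
    exact_mod_cast h2
  have h2 : N + 2 ≤ b + c := by
    have := h.trans (add_le_add_right (min_le_right _ _) _)
    have h2 : (N + 2 : ℚ) ≤ b + c := by linarith
    exact_mod_cast h2
  omega

theorem sum_prod_eq {L : Type*} [Field L] (A : Family L n r) :
    ∑ i : ∀ k, Fin (r k), ∏ k, A k (i k) = ∏ k, ∑ i, A k i := by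
  rw [Finset.prod_univ_sum, Fintype.piFinset_univ]

/-- The expansion of any decomposition of the tensor of a generic family is a permutation of the
expansion of the generic family. -/
theorem IsGeneric.exists_perm {L : Type*} [Field L] {I J K : Finset (Fin d)}
    (hIJ : Disjoint I J) (hIK : Disjoint I K) (hJK : Disjoint J K)
    (hU : I ∪ J ∪ K = Finset.univ) (hk : 2 ≤ ∏ k, r k → 2 * (∏ k, r k) + 2 ≤
      min (∏ k, r k) (dimProd n I) + min (∏ k, r k) (dimProd n J) +
        min (∏ k, r k) (dimProd n K))
    {p : Param n r → L} (hp : IsGeneric I J K p) {B : Family L n r}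
    (hB : IsHHD B (∏ k, ∑ i, paramFamily p k i)) (hne : Nonempty (∀ x, Fin (n x))) :
    ∃ τ : Equiv.Perm (∀ k, Fin (r k)),
      ∀ i : ∀ k, Fin (r k), ∏ k, B k (i k) = ∏ k, paramFamily p k (τ i k) := by
  choose b hb using fun k i => (hB.1 k i).2
  let p' : Param n r → L := fun q => b q.1 q.2.1 q.2.2.1 q.2.2.2
  have hBp : B = paramFamily p' := funext fun k => funext fun i => hb k i
  subst hBp
  have hdec : ∀ (p : Param n r → L) i j, modeVec Finset.univ p i j =
      modeVec I p i j * (modeVec J p i j * modeVec K p i j) := by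
    intro p i j
    rw [← hU, modeVec_union (Finset.disjoint_union_left.2 ⟨hIK, hJK⟩), modeVec_union hIJ,
      mul_assoc]
  -- Reshaping uses three full multi-indices, each read only on its own block; the redundant
  -- coordinates are harmless.
  let glue : (∀ x, Fin (n x)) → (∀ x, Fin (n x)) → (∀ x, Fin (n x)) → ∀ x, Fin (n x) :=
    fun j₁ j₂ j₃ x => if x ∈ I then j₁ x else if x ∈ J then j₂ x else j₃ x
  have hglue : ∀ (p : Param n r → L) i j₁ j₂ j₃,
      modeVec I p i j₁ * (modeVec J p i j₂ * modeVec K p i j₃) =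
        (∏ k, paramFamily p k (i k)) (glue j₁ j₂ j₃) := by
    intro p i j₁ j₂ j₃
    rw [prod_paramFamily_apply, hdec]
    congr 1
    · exact modeVec_congr p i fun x hx => by simp [glue, hx]
    congr 1
    · exact modeVec_congr p i fun x hx => by
        simp [glue, hx, Finset.disjoint_right.1 hIJ hx]
    · exact modeVec_congr p i fun x hx => by
        simp [glue, Finset.disjoint_right.1 hIK hx, Finset.disjoint_right.1 hJK hx]
  have hsum : ∀ p : Param n r → L,
      ∑ i, (fun j₁ j₂ j₃ => modeVec I p i j₁ * (modeVec J p i j₂ * modeVec K p i j₃)) =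
        fun j₁ j₂ j₃ => (∏ k, ∑ i, paramFamily p k i) (glue j₁ j₂ j₃) := by
    intro p
    funext j₁ j₂ j₃
    rw [← sum_prod_eq]
    simp only [Finset.sum_apply, hglue]
  obtain ⟨τ, hτ⟩ := exists_perm_of_sum_eq (K := L) (modeVec I p) (modeVec I p') (modeVec J p)
    (modeVec J p') (modeVec K p) (modeVec K p') _ _ _
    (fun i h0 => by
      obtain ⟨j⟩ := hne
      have := congrFun (congrFun (congrFun h0 j) j) j
      rw [← hdec] at this
      exact Finset.prod_ne_zero_iff.2 (fun x _ => Finset.prod_ne_zero_iff.2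
        fun k _ => hp.ne_zero _) this)
    hp.rank_left hp.rank_mid hp.rank_right ((min_le_left _ _).trans (card_multiIndex r).ge)
    ((min_le_left _ _).trans (card_multiIndex r).ge)
    ((min_le_left _ _).trans (card_multiIndex r).ge) (by rw [card_multiIndex]; exact hk)
    (by rw [hsum, hsum, hB.2])
  refine ⟨τ, fun i => funext fun j => ?_⟩
  have := congrFun (congrFun (congrFun (hτ i) j) j) j
  rw [← hdec, ← hdec] at this
  rw [prod_paramFamily_apply, prod_paramFamily_apply, this]

theorem prod_mul_prod_eq_of_pairs {L : Type*} [Field L] (B : Family L n r)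
    {i j i' j' : ∀ k, Fin (r k)} (h : ∀ k, s(i k, j k) = s(i' k, j' k)) :
    (∏ k, B k (i k)) * ∏ k, B k (j k) = (∏ k, B k (i' k)) * ∏ k, B k (j' k) := by
  rw [← Finset.prod_mul_distrib, ← Finset.prod_mul_distrib]
  refine Finset.prod_congr rfl fun k _ => ?_
  rcases Sym2.eq_iff.1 (h k) with ⟨h1, h2⟩ | ⟨h1, h2⟩
  · rw [h1, h2]
  · rw [h1, h2, mul_comm]

/-- Equal pairs give equal products for any family, in particular `B`; transported by `τ`, this is a
coincidence in the generic family, where only the obvious ones occur. -/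
theorem IsGeneric.perm_preserves {L : Type*} [Field L] {I J K : Finset (Fin d)}
    {p : Param n r → L} (hp : IsGeneric I J K p) {B : Family L n r}
    {τ : Equiv.Perm (∀ k, Fin (r k))}
    (hτ : ∀ i : ∀ k, Fin (r k), ∏ k, B k (i k) = ∏ k, paramFamily p k (τ i k))
    (i j i' j' : ∀ k, Fin (r k)) (h : ∀ k, s(i k, j k) = s(i' k, j' k)) :
    ∀ k, s(τ i k, τ j k) = s(τ i' k, τ j' k) := by
  refine hp.pairs _ _ _ _ ?_
  have := prod_mul_prod_eq_of_pairs B h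
  rw [hτ, hτ, hτ, hτ] at this
  funext t
  have h1 := congrFun this t
  simpa only [Pi.mul_apply, prod_paramFamily_apply] using h1

/-- A tensor over `K` with a decomposition over `K` and a generic decomposition over some extension
of `K` is identifiable over `K`. -/
theorem IsGeneric.identifiable {K L : Type*} [Field K] [Field L] [Algebra K L]
    {I J M : Finset (Fin d)} (hr : ∀ k, 2 ≤ r k)
    (hIJ : Disjoint I J) (hIM : Disjoint I M) (hJM : Disjoint J M)
    (hU : I ∪ J ∪ M = Finset.univ) (hk : 2 ≤ ∏ k, r k → 2 * (∏ k, r k) + 2 ≤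
      min (∏ k, r k) (dimProd n I) + min (∏ k, r k) (dimProd n J) +
        min (∏ k, r k) (dimProd n M))
    (hne : Nonempty (∀ x, Fin (n x))) {p : Param n r → L} (hp : IsGeneric I J M p)
    {T : Tensor K n} (hT : T ∈ hhdTensors K n r)
    (hpT : ∀ j, (∏ k, ∑ i, paramFamily p k i) j = algebraMap K L (T j)) :
    Identifiable r T := by
  have hinj := (algebraMap K L).injective
  let ext : Family K n r → Family L n r := fun A k i j => algebraMap K L (A k i j)
  have hext : ∀ A : Family K n r, IsHHD A T → IsHHD (ext A) (∏ k, ∑ i, paramFamily p k i) := by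
    intro A hA
    refine ⟨fun k i => ⟨fun h0 => (hA.1 k i).1 (funext fun j => hinj ?_), ?_⟩, ?_⟩
    · rw [Pi.zero_apply, map_zero]
      exact congrFun h0 j
    · obtain ⟨a, ha⟩ := (hA.1 k i).2
      refine ⟨fun x j => algebraMap K L (a x j), funext fun j => ?_⟩
      simp [ext, ha, outer]
    · funext j
      rw [hpT, hA.2]
      simp [ext, Finset.prod_apply]
  have hperm : ∀ A : Family K n r, IsHHD A T → ∃ τ : Equiv.Perm (∀ k, Fin (r k)),
      ∀ i : ∀ k, Fin (r k), ∏ k, ext A k (i k) = ∏ k, paramFamily p k (τ i k) :=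
    fun A hA => hp.exists_perm hIJ hIM hJM hU hk (hext A hA) hne
  obtain ⟨A, hA⟩ := hT
  obtain ⟨τ, hτ⟩ := hperm A hA
  have hτp := hp.perm_preserves hτ
  obtain ⟨ψ₁, π₁, hψ₁⟩ := exists_perm_of_preserves_pairs hr τ hτp
  have hA0 : ∀ k i j, A k i j ≠ 0 := by
    intro k i j h0
    let i₀ : ∀ k, Fin (r k) := fun k => ⟨0, by have := hr k; omega⟩
    have h1 := congrFun (hτ (Function.update i₀ k i)) j
    rw [prod_paramFamily_apply, Finset.prod_apply, Finset.prod_eq_zero (Finset.mem_univ k)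
      (by simp [ext, h0])] at h1
    exact Finset.prod_ne_zero_iff.2 (fun x _ => Finset.prod_ne_zero_iff.2
        fun k _ => hp.ne_zero _) h1.symm
  refine identifiable_of_forall_starEquiv hA fun B hB => ?_
  obtain ⟨τ', hτ'⟩ := hperm B hB
  have hτp' := hp.perm_preserves hτ'
  -- The generic family lives over `L`, so two decompositions over `K` are compared by composing
  -- their permutations. That `τ.symm` also preserves pairs follows from the structure of `τ`
  -- already found.
  obtain ⟨ψ, π, hψ⟩ := exists_perm_of_preserves_pairs hr (τ'.trans τ.symm) (by
    intro i j i' j' h k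
    have h1 := hτp' i j i' j' h (ψ₁ k)
    have h2 : ∀ i, τ' i (ψ₁ k) = π₁ k (τ.symm (τ' i) k) := fun i => by
      rw [← hψ₁, Equiv.apply_symm_apply]
    rw [h2, h2, h2, h2] at h1
    exact Sym2.map.injective (π₁ k).injective h1)
  refine starEquiv_of_prod_eq hr hA.1 hB.1 hA0 (τ'.trans τ.symm) (fun i => ?_) ψ π hψ
  have h1 : ∏ k, ext B k (i k) = ∏ k, ext A k ((τ'.trans τ.symm) i k) := by
    rw [hτ', hτ]
    simp
  funext j
  refine hinj ?_
  have := congrFun h1 j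
  simpa [ext, Finset.prod_apply] using this

theorem isHHD_paramFamily {L : Type*} [Field L] {p : Param n r → L} (hp : ∀ q, p q ≠ 0)
    (hne : Nonempty (∀ x, Fin (n x))) :
    IsHHD (paramFamily p) (∏ k, ∑ i, paramFamily p k i) := by
  refine ⟨fun k i => ⟨fun h0 => ?_, _, rfl⟩, rfl⟩
  obtain ⟨j⟩ := hne
  have h1 : ∏ x, p ⟨k, i, x, j x⟩ = 0 := congrFun h0 j
  exact Finset.prod_ne_zero_iff.2 (fun x _ => hp _) h1

/-- Pulling back to zero implies vanishing on every tensor with an HHD, hence on the closure; this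
is the hypothesis of the lifting result. -/
theorem aeval_eq_zero_of_mem_hhdVariety {K : Type*} [Field K] {T : Tensor K n}
    (hT : T ∈ hhdVariety K n r) {q : MvPolynomial (∀ x, Fin (n x)) K}
    (hq : aeval (hhdPoly K n r) q = 0) : aeval T q = 0 := by
  refine hT q fun T' hT' => ?_
  obtain ⟨A, hA⟩ := hT'
  choose a ha using fun k i => (hA.1 k i).2
  let p : Param n r → K := fun q => a q.1 q.2.1 q.2.2.1 q.2.2.2
  have hAp : A = paramFamily p := funext fun k => funext fun i => ha k i
  have h1 : T' = fun j => aeval p (hhdPoly K n r j) := by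
    funext j
    rw [aeval_hhdPoly, ← hAp, hA.2]
  have h2 : aeval T' q = aeval p (aeval (hhdPoly K n r) q) := by
    rw [h1, ← AlgHom.comp_apply]
    congr 1
    exact algHom_ext fun j => by simp
  rw [h2, hq, map_zero]

end HHD

end

/-! ### The exceptional closed set -/

theorem mainTheorem3 {K : Type*} [Field K] [CharZero K] {d m : ℕ}
    (n : Fin d → ℕ) (r : Fin m → ℕ) (hr : ∀ k, 2 ≤ r k)
    (hR : HHD.InKruskalRange n (∏ k, r k)) :
    ∃ Z : Set (HHD.Tensor K n),
      HHD.IsZariskiClosed Z ∧ Z ⊂ HHD.hhdVariety K n r ∧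
      (∀ T ∈ HHD.hhdTensors K n r, T ∉ Z → HHD.Identifiable r T) ∧
      (IsAlgClosed K → ∀ T ∈ HHD.hhdVariety K n r, T ∉ Z → HHD.Identifiable r T) := by
  obtain ⟨I, J, M, hIJ, hIM, hJM, hU, hba, hcb, hc, hR⟩ := hR
  have hk := fun h => HHD.two_mul_add_two_le hba hcb hc h hR
  have hpos : ∀ X : Finset (Fin d), 2 ≤ HHD.dimProd n X → ∀ x ∈ X, 0 < n x := fun X hX x hx =>
    Nat.pos_of_ne_zero (Finset.prod_ne_zero_iff.1
      (show HHD.dimProd n X ≠ 0 by omega) x hx)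
  have hn : ∀ x, 0 < n x := by
    intro x
    have hx := Finset.mem_univ x
    rw [← hU, Finset.mem_union, Finset.mem_union] at hx
    rcases hx with (hx | hx) | hx
    · exact hpos I (by omega) x hx
    · exact hpos J (by omega) x hx
    · exact hpos M hc x hx
  have hne : Nonempty (∀ x, Fin (n x)) := ⟨fun x => ⟨0, hn x⟩⟩
  obtain ⟨x₀, -⟩ : M.Nonempty := by
    rw [Finset.nonempty_iff_ne_empty]
    rintro rfl
    simp [HHD.dimProd] at hc
  obtain ⟨g, hg, hgen⟩ := HHD.holdsGenerically_isGeneric (r := r) K hn x₀ I J M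
  obtain ⟨f, hf, hlift⟩ := exists_lift_of_mem_closure_of_ne_zero (HHD.hhdPoly K n r) hg
  have hsub : HHD.hhdTensors K n r ⊆ HHD.hhdVariety K n r :=
    fun T hT q hq => hq T hT
  have key : ∀ T ∈ HHD.hhdVariety K n r, MvPolynomial.aeval T f ≠ 0 →
      ∀ (L : Type _) [Field L] [Algebra K L] [IsAlgClosed L], ∃ p : HHD.Param n r → L,
        HHD.IsGeneric I J M p ∧
          ∀ j, (∏ k, ∑ i, HHD.paramFamily p k i) j = algebraMap K L (T j) := by
    intro T hT hTf L _ _ _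
    obtain ⟨p, hp, hpg⟩ := hlift T
      (fun q hq => HHD.aeval_eq_zero_of_mem_hhdVariety hT hq) hTf L
    exact ⟨p, hgen L p hpg, fun j => by rw [← hp j, HHD.aeval_hhdPoly]⟩
  have hid : ∀ T ∈ HHD.hhdTensors K n r, MvPolynomial.aeval T f ≠ 0 →
      HHD.Identifiable r T := by
    intro T hT hTf
    obtain ⟨p, hp, hpT⟩ := key T (hsub hT) hTf (AlgebraicClosure K)
    exact hp.identifiable hr hIJ hIM hJM hU hk hne hT hpT
  refine ⟨{T | T ∈ HHD.hhdVariety K n r ∧ MvPolynomial.aeval T f = 0}, ?_, ?_, ?_, ?_⟩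
  · refine ⟨MvPolynomial.vanishingIdeal K (HHD.hhdTensors K n r) ⊔ Ideal.span {f}, ?_⟩
    ext T
    constructor
    · rintro ⟨h1, h2⟩ q hq
      obtain ⟨a, ha, b, hb, rfl⟩ := Submodule.mem_sup.1 hq
      obtain ⟨c, rfl⟩ := Ideal.mem_span_singleton'.1 hb
      rw [map_add, map_mul, h2, mul_zero, add_zero]
      exact h1 a ha
    · intro h
      exact ⟨fun q hq => h q (Ideal.mem_sup_left hq),
        h f (Ideal.mem_sup_right (Ideal.mem_span_singleton_self f))⟩
  · refine ⟨fun T hT => hT.1, fun h => ?_⟩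
    -- Since `K` is infinite, a nonzero polynomial has a nonzero value at a `K`-point; the tensor of
    -- this `p` has an HHD and lies outside the exceptional set.
    obtain ⟨p, hp⟩ : ∃ p : HHD.Param n r → K, MvPolynomial.aeval p
        (MvPolynomial.aeval (HHD.hhdPoly K n r) f * g) ≠ 0 := by
      by_contra hcon
      push Not at hcon
      refine mul_ne_zero hf hg (MvPolynomial.funext fun p => ?_)
      rw [map_zero, ← MvPolynomial.coe_aeval_eq_eval]
      exact hcon p
    rw [map_mul] at hp
    have hgenp := hgen K p (right_ne_zero_of_mul hp)
    have h1 := h (hsub ⟨_, HHD.isHHD_paramFamily hgenp.ne_zero hne⟩)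
    refine left_ne_zero_of_mul hp ?_
    rw [← h1.2, ← AlgHom.comp_apply]
    congr 1
    refine MvPolynomial.algHom_ext fun j => ?_
    rw [AlgHom.comp_apply, MvPolynomial.aeval_X, MvPolynomial.aeval_X, HHD.aeval_hhdPoly]
  · exact fun T hT hTZ => hid T hT fun h0 => hTZ ⟨hsub hT, h0⟩
  · intro _ T hT hTZ
    have hTf : MvPolynomial.aeval T f ≠ 0 := fun h0 => hTZ ⟨hT, h0⟩
    -- Lifting over `K` itself provides the HHD of `T`.
    obtain ⟨p, hp, hpT⟩ := key T hT hTf K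
    have h1 : T = ∏ k, ∑ i, HHD.paramFamily p k i := funext fun j => (hpT j).symm
    exact hid T (h1 ▸ ⟨_, HHD.isHHD_paramFamily hp.ne_zero hne⟩) hTf
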